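/- Let $V,V'$ be real vector spaces in perfect duality and let $\Phi\subset V$ be a finite crystallographic root system (with coroots in $V'$), not necessarily reduced and not necessarily spanning $V$. Let $W$ be its Weyl group, $\Delta$ a set of simple roots, $\Phi^+$ the corresponding positive roots, and let $\theta\subseteq\Delta$. (Guiding case: $G$ is a connected reductive group over a non-archimedean local field of characteristic $0$, $T$ a minimal Levi subgroup, $V=\mathfrak a_T^*$, $\Phi$ the root system of $G$ with respect to $T$, and $\theta$ the set of simple roots of a standard Levi subgroup $M$. The notation below follows this case.) For a subspace $S\subseteq V$ let $W^S$ be the subgroup of $W$ generated by the reflections in $\Phi\cap S$, and let $w_0^S$ be its longest element with respect to the positive roots $\Phi^+\cap S$. Put * $S_M=\operatorname{span}_{\mathbb R}\theta$, $\Phi^M=\Phi\cap S_M$, $W^M=W^{S_M}$, $\mathfrak a_M^*=V/S_M$; write $w.M=M$ if $w\Phi^M=\Phi^M$; * $W_M=\{w\in W: w.M=M\}/W^M$, the relative Weyl group, which acts on $\mathfrak a_M^*$; * $\Phi_M$, the set of reduced relative roots: the nonzero images in $\mathfrak a_M^*$ of the roots in $\Phi$ that are not of the form $n\gamma$ with $n\ge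 2$ an integer and $\gamma$ another such image; a relative root is positive ($>0$) if it is the image of a positive root; * for $\alpha\in\Phi_M$, the relative reflection $w_\alpha=w_0^{M_\alpha}w_0^M\in W$, where $w_0^M=w_0^{S_M}$ and $w_0^{M_\alpha}=w_0^{S_\alpha}$ with $S_\alpha$ the preimage of $\mathbb R\alpha$ in $V$ (so $\Phi\cap S_\alpha$ is the root system of the co-rank one Levi subgroup $M_\alpha\supseteq M$); * $\Phi_M^0=\{\alpha\in\Phi_M: w_\alpha.M=M\}$ and $(\Phi_M^0)^+=\{\alpha\in\Phi_M^0:\alpha>0\}$; * $W_M^0=\langle w_\alpha:\alpha\in\Phi_M^0\rangle\subseteq W_M$ and $W_M^1=\{w\in W_M: w.(\Phi_M^0)^+>0\}$. Then $W_M^1$ is a subgroup of $W_M$, equal to the stabilizer of the set $(\Phi_M^0)^+$; the subgroup $W_M^0$ is normal in $W_M$; and $$W_M=W_M^0\rtimes W_M^1 .$$ Moreover $\Phi_M^0$ is a relative subroot system (possibly empty or reducible): it is a finite reduced crystallographic root system in the subspace of $\mathfrak a_M^*$ that it spans, and for every $\alpha\in\Phi_M^0$ the class of $w_\alpha$ in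 $W_M$ acts on $\mathfrak a_M^*$ as the reflection in $\alpha$ of this root system. -/

import Mathlib

open scoped Pointwise

noncomputable section

namespace RelativeWeyl

variable {ι V V' : Type*} [AddCommGroup V] [Module ℝ V] [AddCommGroup V'] [Module ℝ V']

/-- A set of simple roots of a (not necessarily reduced, not necessarily spanning) root pairing:
a linearly independent set of roots such that every root is, up to sign, a sum of simple roots.
For non-reduced root pairings the structure `RootPairing.Base` of Mathlib would be too
restrictive, since it also constrains the coroots. -/
structure SimpleRoots (P : RootPairing ι ℝ V V') where
  support : Set ι
  linearIndepOn_root : LinearIndepOn ℝ P.root support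
  root_mem_or_neg_mem (i : ι) : P.root i ∈ AddSubmonoid.closure (P.root '' support) ∨
    -P.root i ∈ AddSubmonoid.closure (P.root '' support)

/-- The root `i` is positive: it is a sum of simple roots. -/
def SimpleRoots.IsPos {P : RootPairing ι ℝ V V'} (Δ : SimpleRoots P) (i : ι) : Prop :=
  P.root i ∈ AddSubmonoid.closure (P.root '' Δ.support)

variable (P : RootPairing ι ℝ V V') (Δ : SimpleRoots P) (θ : Set ι)

/-! ### Levi subgroups

A semistandard Levi subgroup is the centralizer of a subtorus of the maximal split torus, and it is
recorded by the subspace `S` of `V` of all characters that are trivial on the subtorus: its roots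
are the roots in `S`. -/

/-- The roots of the semistandard Levi subgroup `L` attached to the subspace `S`. -/
def leviRoots (S : Submodule ℝ V) : Set ι := {i | P.root i ∈ S}

/-- The Weyl group `W^L` of `L`, generated by the reflections in the roots of `L`. -/
def leviWeyl (S : Submodule ℝ V) : Subgroup P.weylGroup :=
  Subgroup.closure (RootPairing.weylGroup.ofIdx P '' leviRoots P S)

variable {P} in
/-- The length of `w` as an element of the Weyl group of `L`: the number of reduced positive roots
of `L` which `w` makes negative. -/
def leviLength (S : Submodule ℝ V) (w : P.weylGroup) : ℕ :=
  Set.ncard {i ∈ leviRoots P S |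
    (∀ j, P.root i ≠ (2 : ℝ) • P.root j) ∧ Δ.IsPos i ∧ ¬ Δ.IsPos (w • i)}

variable {P} in
/-- `w` is an element of maximal length of `W^L`. -/
def IsLongest (S : Submodule ℝ V) (w : P.weylGroup) : Prop :=
  w ∈ leviWeyl P S ∧ ∀ u ∈ leviWeyl P S, leviLength Δ S u ≤ leviLength Δ S w

variable {P} in
theorem exists_isLongest [Finite ι] (S : Submodule ℝ V) :
    ∃ w : P.weylGroup, IsLongest Δ S w := by
  let A : Set ℕ := leviLength Δ S '' (leviWeyl P S : Set P.weylGroup)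
  have hne : A.Nonempty := ⟨_, 1, one_mem _, rfl⟩
  have hb : BddAbove A := by
    refine ⟨Nat.card ι, ?_⟩
    rintro _ ⟨w, -, rfl⟩
    exact Set.ncard_le_card _
  obtain ⟨w, hw, hwA⟩ := Nat.sSup_mem hne hb
  exact ⟨w, hw, fun u hu ↦ hwA ▸ le_csSup hb ⟨u, hu, rfl⟩⟩

variable {P} in
/-- The longest element `w_0^L` of the Weyl group `W^L`. -/
def longest [Finite ι] (S : Submodule ℝ V) : P.weylGroup :=
  (exists_isLongest Δ S).choose

/-! ### The standard Levi subgroup `M` attached to a set `θ` of simple roots -/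

/-- The subspace attached to the standard Levi subgroup `M`, spanned by the roots in `θ`. -/
def leviSpan : Submodule ℝ V := Submodule.span ℝ (P.root '' θ)

/-- The space `𝔞_M^*`, the quotient of `𝔞_T^* = V` obtained by restricting characters to the
maximal split torus in the centre of `M`. -/
abbrev RelSpace : Type _ := V ⧸ leviSpan P θ

/-- The group `{w ∈ W : w.M = M}`. -/
def leviStabilizer : Subgroup P.weylGroup :=
  MulAction.stabilizer P.weylGroup (leviRoots P (leviSpan P θ))

variable {P θ} in
theorem mem_leviStabilizer {w : P.weylGroup} (hw : w ∈ leviStabilizer P θ) (i : ι) :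
    P.root (w • i) ∈ leviSpan P θ ↔ P.root i ∈ leviSpan P θ := by
  have h : w • leviRoots P (leviSpan P θ) = leviRoots P (leviSpan P θ) := hw
  have h2 : w • i ∈ w • leviRoots P (leviSpan P θ) ↔ i ∈ leviRoots P (leviSpan P θ) :=
    Set.smul_mem_smul_set_iff
  rw [h] at h2
  exact h2

theorem root_smul (w : P.weylGroup) (i : ι) : P.root (w • i) = w • P.root i :=
  (P.weylGroup_apply_root w i).symm

theorem conj_ofIdx (w : P.weylGroup) (i : ι) :
    w * RootPairing.weylGroup.ofIdx P i * w⁻¹ = RootPairing.weylGroup.ofIdx P (w • i) := by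
  rw [mul_inv_eq_iff_eq_mul]
  apply Subtype.ext
  apply RootPairing.Equiv.weightHom_injective P
  refine LinearEquiv.ext fun x ↦ ?_
  have hco : P.coroot' (w • i) (w • x) = P.coroot' i x := by
    have h1 := RootPairing.Hom.coroot_coweightMap_apply P P (w • i) (w : P.Aut).toHom
    have h2 := LinearMap.congr_fun (RootPairing.Hom.weight_coweight_transpose_apply P P
      (P.coroot (w • i)) (w : P.Aut).toHom) x
    rw [h1] at h2
    have h3 : (w : P.Aut).toHom.indexEquiv.symm (w • i) = i :=
      (w : P.Aut).toHom.indexEquiv.symm_apply_apply i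
    rw [h3] at h2
    exact h2
  change w • P.reflection i x = P.reflection (w • i) (w • x)
  rw [P.reflection_apply, P.reflection_apply, hco, root_smul, smul_sub, smul_comm]

/-- `W^M` is normal in `{w ∈ W : w.M = M}`. -/
instance leviWeyl_normal :
    ((leviWeyl P (leviSpan P θ)).subgroupOf (leviStabilizer P θ)).Normal := by
  refine ⟨fun n hn g ↦ ?_⟩
  rw [Subgroup.mem_subgroupOf] at hn ⊢
  have key : leviWeyl P (leviSpan P θ) ≤
      (leviWeyl P (leviSpan P θ)).comap (MulAut.conj (g : P.weylGroup)).toMonoidHom := by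
    conv_lhs => rw [leviWeyl]
    rw [Subgroup.closure_le]
    rintro _ ⟨i, hi, rfl⟩
    change (g : P.weylGroup) * RootPairing.weylGroup.ofIdx P i * (g : P.weylGroup)⁻¹ ∈
      leviWeyl P (leviSpan P θ)
    rw [conj_ofIdx]
    exact Subgroup.subset_closure ⟨_, (mem_leviStabilizer g.2 i).2 hi, rfl⟩
  exact key hn

/-- The relative Weyl group `W_M = {w ∈ W : w.M = M} / W^M`. -/
abbrev RelWeylGroup : Type _ :=
  leviStabilizer P θ ⧸ (leviWeyl P (leviSpan P θ)).subgroupOf (leviStabilizer P θ)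

theorem leviSpan_le_comap (w : leviStabilizer P θ) :
    leviSpan P θ ≤ (leviSpan P θ).comap (P.weylGroupRootRep (w : P.weylGroup)) := by
  rw [leviSpan, Submodule.span_le]
  rintro _ ⟨i, hi, rfl⟩
  have := (mem_leviStabilizer w.2 i).2 (Submodule.subset_span ⟨i, hi, rfl⟩)
  rw [root_smul] at this
  exact this

/-- The action of `{w ∈ W : w.M = M}` on `𝔞_M^*`. -/
def stabilizerRep : leviStabilizer P θ →* Module.End ℝ (RelSpace P θ) where
  toFun w := Submodule.mapQ _ _ (P.weylGroupRootRep (w : P.weylGroup)) (leviSpan_le_comap P θ w)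
  map_one' := by
    ext x
    simp
  map_mul' u w := by
    ext x
    simp

variable {P θ} in
theorem reflection_sub_mem (i : ι) (hi : i ∈ leviRoots P (leviSpan P θ)) (x : V) :
    RootPairing.weylGroup.ofIdx P i • x - x ∈ leviSpan P θ := by
  change P.reflection i x - x ∈ _
  rw [P.reflection_apply, sub_sub_cancel_left, neg_mem_iff]
  exact Submodule.smul_mem _ _ hi

theorem stabilizerRep_eq_one (w : leviStabilizer P θ)
    (hw : w ∈ (leviWeyl P (leviSpan P θ)).subgroupOf (leviStabilizer P θ)) :
    stabilizerRep P θ w = 1 := by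
  rw [Subgroup.mem_subgroupOf] at hw
  have key : ∀ u ∈ leviWeyl P (leviSpan P θ), ∀ x : V, u • x - x ∈ leviSpan P θ := by
    intro u hu
    induction hu using Subgroup.closure_induction'' with
    | one => simp
    | mem u hu =>
      obtain ⟨i, hi, rfl⟩ := hu
      exact reflection_sub_mem i hi
    | inv_mem u hu =>
      obtain ⟨i, hi, rfl⟩ := hu
      have h : (RootPairing.weylGroup.ofIdx P i)⁻¹ = RootPairing.weylGroup.ofIdx P i :=
        Subtype.ext (RootPairing.Equiv.reflection_inv P i)
      rw [h]
      exact reflection_sub_mem i hi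
    | mul u v _ _ hu hv =>
      intro x
      have := add_mem (hu (v • x)) (hv x)
      rwa [sub_add_sub_cancel, smul_smul] at this
  ext x
  exact (Submodule.Quotient.eq _).2 (key _ hw x)

/-- The action of the relative Weyl group `W_M` on `𝔞_M^*`. -/
def relRep : RelWeylGroup P θ →* Module.End ℝ (RelSpace P θ) :=
  QuotientGroup.lift _ (stabilizerRep P θ) (stabilizerRep_eq_one P θ)

/-- The relative roots of `M`: the nonzero restrictions of roots. -/
def relRoots : Set (RelSpace P θ) :=
  {β | β ≠ 0 ∧ ∃ i, (leviSpan P θ).mkQ (P.root i) = β}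

/-- The set `Φ_M` of reduced relative roots: those that are not a proper multiple of another
relative root. -/
def reducedRelRoots : Set (RelSpace P θ) :=
  {β ∈ relRoots P θ | ∀ γ ∈ relRoots P θ, ∀ n : ℕ, 2 ≤ n → β ≠ n • γ}

variable {P} in
/-- A relative root is positive if it is the restriction of a positive root, that is, if it occurs
in the unipotent radical of the standard parabolic subgroup with Levi subgroup `M`. -/
def IsRelPos (β : RelSpace P θ) : Prop :=
  β ≠ 0 ∧ ∃ i, Δ.IsPos i ∧ (leviSpan P θ).mkQ (P.root i) = β

variable {P θ} in
/-- The subspace attached to the co-rank one Levi subgroup `M_β ⊇ M` of a relative root `β`: the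
roots of `M_β` are the roots whose restriction is a multiple of `β`. -/
def corankOneSpan (β : RelSpace P θ) : Submodule ℝ V :=
  (Submodule.span ℝ {β}).comap (leviSpan P θ).mkQ

variable {P θ} in
/-- The relative reflection `w_β = w_0^{M_β} w_0^M`, an element of `W`. -/
def relReflection [Finite ι] (β : RelSpace P θ) : P.weylGroup :=
  longest Δ (corankOneSpan β) * longest Δ (leviSpan P θ)

variable {P} in
/-- The set `Φ_M^0` of reduced relative roots `β` with `w_β.M = M`. -/
def relRootsZero [Finite ι] : Set (RelSpace P θ) :=
  {β ∈ reducedRelRoots P θ | relReflection Δ β ∈ leviStabilizer P θ}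

variable {P θ} in
/-- The class in `W_M` of the relative reflection `w_β`, for `β ∈ Φ_M^0`. -/
def relReflectionClass [Finite ι] (β : relRootsZero Δ θ) : RelWeylGroup P θ :=
  QuotientGroup.mk ⟨relReflection Δ β.1, β.2.2⟩

variable {P} in
/-- The set `(Φ_M^0)^+` of positive elements of `Φ_M^0`. -/
def relRootsZeroPos [Finite ι] : Set (RelSpace P θ) :=
  {β ∈ relRootsZero Δ θ | IsRelPos Δ θ β}

variable {P} in
/-- The small relative Weyl group `W_M^0`, generated by the `w_β` with `β ∈ Φ_M^0`. -/
def relWeylZero [Finite ι] : Subgroup (RelWeylGroup P θ) :=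
  Subgroup.closure (Set.range (relReflectionClass Δ (θ := θ)))

variable {P} in
/-- The set `W_M^1 = {w ∈ W_M : w.(Φ_M^0)^+ > 0}`. -/
def relWeylOne [Finite ι] : Set (RelWeylGroup P θ) :=
  {w | ∀ β ∈ relRootsZeroPos Δ θ, IsRelPos Δ θ (relRep P θ w β)}

end RelativeWeyl

end

/-! The semidirect product is an instance of a general fact, isolated in `ReflectionDatum`. Let a
finite group act faithfully on a real space and preserve a finite reduced root system whose
reflections it contains. Then the reflections generate a normal subgroup, and the stabilizer of a
positive system is a complement (`ReflectionDatum.isComplement'`). The complement property rests on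
two facts: every functional can be moved by reflections into the closed dominant chamber
(`exists_dominant`, by maximizing over the finite group), and a product of reflections preserving a
positive system is trivial (`eq_one_of_pos`, by the exchange condition).

The relative part checks these hypotheses for `W_M` acting on `Φ_M^0`. Positivity is encoded by
functionals, `height` on `V` and `relHeight` on the quotient. Comparing their signs shows that `w_β`
sends `β` to `-β` (`stabilizerRep_relReflection`), and that any element of `W^{M_β}` normalizing `M`
and negating `β` forces `w_β.M = M` (`relReflection_mem_leviStabilizer`); by conjugation `Φ_M^0` is
therefore stable under `W_M`. Integrality holds because `M_β` has only one simple root outside `M`,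
so all its roots restrict to integral multiples of `β` (`exists_zsmul_of_mem_corankOneSpan`).
Faithfulness again combines dominance and freeness, now in `W`. -/

noncomputable section

namespace RelativeWeyl

open Module

/-! ### Invariant forms and dominant translates -/

section Invariant

variable {E : Type*} [AddCommGroup E] [Module ℝ E] [FiniteDimensional ℝ E]

/-- A representation of a finite group on a finite-dimensional real vector space has an invariant
inner product. -/
theorem exists_invariant_form {G : Type*} [Group G] [Finite G] (ρ : G →* End ℝ E) :
    ∃ B : LinearMap.BilinForm ℝ E, (∀ x y, B x y = B y x) ∧ (∀ x, x ≠ 0 → 0 < B x x) ∧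
      ∀ g x y, B (ρ g x) (ρ g y) = B x y := by
  have := Fintype.ofFinite G
  let b := finBasis ℝ E
  let B : LinearMap.BilinForm ℝ E := ∑ g : G, ∑ i,
    (b.coord i ∘ₗ ρ g).smulRight (b.coord i ∘ₗ ρ g)
  have hB (x y : E) : B x y = ∑ g : G, ∑ i, b.repr (ρ g x) i * b.repr (ρ g y) i := by
    simp [B, LinearMap.sum_apply]
  refine ⟨B, fun x y ↦ ?_, fun x hx ↦ ?_, fun g x y ↦ ?_⟩
  · simp only [hB, mul_comm]
  · rw [hB]
    have hnn (g : G) : 0 ≤ ∑ i, b.repr (ρ g x) i * b.repr (ρ g x) i :=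
      Finset.sum_nonneg fun i _ ↦ mul_self_nonneg _
    refine lt_of_lt_of_le ?_ (Finset.single_le_sum (fun g _ ↦ hnn g) (Finset.mem_univ 1))
    refine (hnn 1).lt_of_ne' fun h ↦ hx ?_
    rw [Finset.sum_eq_zero_iff_of_nonneg fun i _ ↦ mul_self_nonneg _] at h
    apply b.repr.injective
    ext i
    simpa using h i (Finset.mem_univ i)
  · simp only [hB, ← End.mul_apply, ← map_mul]
    exact Fintype.sum_equiv (Equiv.mulRight g) _ _ fun h ↦ rfl

omit [FiniteDimensional ℝ E] in
/-- An invariant form determines the functional of a reflection. -/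
theorem mul_form_eq_of_reflection {B : LinearMap.BilinForm ℝ E}
    {s : End ℝ E} (hB : ∀ x y, B (s x) (s y) = B x y) {f : Dual ℝ E} {a : E}
    (h : ∀ x, s x = x - f x • a) (ha : f a = 2) (x : E) : f x * B a a = 2 * B x a := by
  have h1 := hB x a
  rw [h, h, ha] at h1
  simp only [map_sub, map_smul, LinearMap.sub_apply, LinearMap.smul_apply, smul_eq_mul] at h1
  linarith

/-- If `H` contains reflections in all `a ∈ A`, then every functional `μ` has a translate under `H`
that is nonnegative at those `a ∈ A` where `l` is positive. -/
theorem exists_dominant {G : Type*} [Group G] [Finite G] (ρ : G →* End ℝ E) (H : Subgroup G)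
    (A : Set E) (hA : ∀ a ∈ A, ∃ s ∈ H, ∃ f : Dual ℝ E, f a = 2 ∧ ∀ x, ρ s x = x - f x • a)
    (l μ : Dual ℝ E) : ∃ h ∈ H, ∀ a ∈ A, 0 < l a → 0 ≤ μ (ρ h a) := by
  obtain ⟨B, -, hp, hB⟩ := exists_invariant_form ρ
  have hnd : B.Nondegenerate :=
    ⟨fun x hx ↦ by_contra fun h ↦ (hp x h).ne' (hx x),
      fun x hx ↦ by_contra fun h ↦ (hp x h).ne' (hx x)⟩
  obtain ⟨x, hx⟩ : ∃ x, ∀ y, B x y = l y :=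
    ⟨(B.toDual hnd).symm l, fun y ↦ LinearMap.BilinForm.apply_toDual_symm_apply (hB := hnd) l y⟩
  -- Here `x` represents `l` under the invariant form. If `l a > 0`, then `f x > 0`, so a negative
  -- value of `μ (ρ h a)` would let `h * s` beat the maximum.
  obtain ⟨h, hh⟩ := Finite.exists_max fun h : H ↦ μ (ρ h x)
  refine ⟨h, h.2, fun a ha hla ↦ ?_⟩
  obtain ⟨s, hsH, f, hfa, hf⟩ := hA a ha
  have ha0 : a ≠ 0 := by rintro rfl; simp at hla
  have h1 := mul_form_eq_of_reflection (hB s) hf hfa x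
  rw [hx] at h1
  have hfx : 0 < f x := by
    have := hp a ha0
    by_contra! hc
    nlinarith
  have h2 : μ (ρ h (ρ s x)) ≤ μ (ρ h x) := by
    simpa using hh (h * ⟨s, hsH⟩)
  rw [hf, map_sub, map_sub, map_smul, map_smul, smul_eq_mul] at h2
  by_contra! hc
  nlinarith

end Invariant

/-! ### Linear functionals and sums of simple vectors -/

/-- A functional that is nonnegative on a set of vectors is nonnegative on the sums of these
vectors, and vanishes only on the sums of vectors in its kernel. -/
theorem nonneg_of_mem_closure {κ E : Type*} [AddCommGroup E] [Module ℝ E] {v : κ → E}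
    {s t : Set κ} {f : Dual ℝ E} (hf : ∀ i ∈ s, 0 ≤ f (v i)) (ht : ∀ i ∈ s, f (v i) = 0 → i ∈ t)
    {x : E} (hx : x ∈ AddSubmonoid.closure (v '' s)) :
    0 ≤ f x ∧ (f x = 0 → x ∈ Submodule.span ℝ (v '' t)) := by
  induction hx using AddSubmonoid.closure_induction with
  | mem x hx =>
    obtain ⟨i, hi, rfl⟩ := hx
    exact ⟨hf i hi, fun h ↦ Submodule.subset_span ⟨i, ht i hi h, rfl⟩⟩
  | zero => simp
  | add x y _ _ hx hy =>
    rw [map_add]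
    exact ⟨add_nonneg hx.1 hy.1, fun h ↦ add_mem (hx.2 (by linarith [hx.1, hy.1]))
      (hy.2 (by linarith [hx.1, hy.1]))⟩

/-- There are functionals with arbitrary values on a linearly independent family. -/
theorem exists_dual_apply_eq {κ E : Type*} [AddCommGroup E] [Module ℝ E] {v : κ → E}
    {s : Set κ} (hli : LinearIndepOn ℝ v s) (c : κ → ℝ) :
    ∃ f : Dual ℝ E, ∀ i ∈ s, f (v i) = c i := by
  obtain ⟨f, hf⟩ := (Finsupp.linearCombination ℝ (fun i : s ↦ c i) ∘ₗ
    LinearIndependent.repr hli).exists_extend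
  refine ⟨f, fun i hi ↦ ?_⟩
  have hm : v i ∈ Submodule.span ℝ (Set.range fun i : s ↦ v i) :=
    Submodule.subset_span ⟨⟨i, hi⟩, rfl⟩
  have := LinearMap.congr_fun hf ⟨v i, hm⟩
  rw [LinearMap.comp_apply, Submodule.subtype_apply] at this
  rw [this]
  have h2 := LinearIndependent.repr_eq_single hli ⟨i, hi⟩ ⟨v i, hm⟩ rfl
  rw [LinearMap.comp_apply, h2]
  simp

/-! ### Simple reflections, exchange, and freeness on positive systems -/

section Free

variable {ι V V' : Type*} [Finite ι] [AddCommGroup V] [Module ℝ V] [AddCommGroup V'] [Module ℝ V']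
  (Q : RootPairing ι ℝ V V')

omit [Finite ι] in
theorem rootForm_root_self_pos [Fintype ι] (i : ι) : 0 < Q.RootForm (Q.root i) (Q.root i) := by
  rw [Q.rootForm_apply_apply]
  refine Finset.sum_pos' (fun k _ ↦ mul_self_nonneg _) ⟨i, Finset.mem_univ i, ?_⟩
  simp

omit [Finite ι] in
/-- An isometry moving one root to a multiple of another conjugates the reflections. -/
theorem mul_reflection_eq [Fintype ι] {u : V ≃ₗ[ℝ] V}
    (hu : ∀ x y, Q.RootForm (u x) (u y) = Q.RootForm x y)
    {i j : ι} {c : ℝ} (h : u (Q.root i) = c • Q.root j) :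
    u * Q.reflection i = Q.reflection j * u := by
  have hpos (k : ι) : Q.RootForm (Q.root k) (Q.root k) ≠ 0 :=
    (rootForm_root_self_pos Q k).ne'
  have hf (k : ι) (x : V) := mul_form_eq_of_reflection (B := Q.RootForm)
    (s := (Q.reflection k : V →ₗ[ℝ] V)) (Q.rootForm_reflection_reflection_apply k)
    (Q.reflection_apply k) (by simp) x
  have hii : Q.RootForm (Q.root i) (Q.root i) = c * c * Q.RootForm (Q.root j) (Q.root j) := by
    rw [← hu, h]; simp [mul_assoc]
  have hc : c ≠ 0 := by rintro rfl; exact hpos i (by rw [hii]; simp)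
  ext y
  change u (Q.reflection i y) = Q.reflection j (u y)
  rw [Q.reflection_apply, Q.reflection_apply, map_sub, map_smul, h, smul_smul]
  congr 2
  have h1 := hf i y
  have h2 := hf j (u y)
  rw [hii, ← hu y, h, map_smul, smul_eq_mul] at h1
  have h3 : c * Q.RootForm (Q.root j) (Q.root j) * (Q.coroot' i y * c - Q.coroot' j (u y)) = 0 := by
    linear_combination h1 - c * h2
  simpa [hc, hpos j, sub_eq_zero] using h3

variable [Q.IsCrystallographic] (l : Dual ℝ V)

/-- The simple roots of the positive system defined by a functional. -/
abbrev simples : Set ι := IsAddIndecomposable.baseOf Q.root (l : V →+ ℝ)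

variable {Q l}

omit [Q.IsCrystallographic] in
theorem root_mem_closure_simples {i : ι} (hi : 0 < l (Q.root i)) :
    Q.root i ∈ AddSubmonoid.closure (Q.root '' simples Q l) := by
  have h := AddSubmonoid.closure_image_isAddIndecomposable_baseOf Q.root (l : V →+ ℝ)
  rw [h]
  exact AddSubmonoid.subset_closure ⟨i, hi, rfl⟩

omit [Finite ι] [Q.IsCrystallographic] in
theorem exists_neg_root (i : ι) : ∃ j, Q.root j = -Q.root i :=
  ⟨Q.reflectionPerm i i, by simp⟩

/-- Subtracting a multiple of the simple root `i` leaves the coefficients at the other simple roots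
unchanged, and one of these is positive. The functional `f` adds them up. Excluding the whole line
of `i`, rather than `i` alone, accommodates non-reduced systems. -/
theorem reflection_pos (hl : ∀ i, l (Q.root i) ≠ 0) {i j : ι} (hi : i ∈ simples Q l)
    (hj : 0 < l (Q.root j)) (hij : Q.root j ∉ Submodule.span ℝ {Q.root i}) :
    0 < l (Q.reflection i (Q.root j)) := by
  classical
  obtain ⟨f, hf⟩ := exists_dual_apply_eq (Q.linearIndepOn_root_baseOf' l hl)
    (fun k ↦ if k = i then 0 else 1)
  have key {k : ι} (hk : 0 < l (Q.root k)) := nonneg_of_mem_closure (f := f) (t := {i})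
    (fun k hk ↦ by rw [hf k hk]; split_ifs <;> simp)
    (fun k hk h0 ↦ by rw [hf k hk] at h0; simpa using h0) (root_mem_closure_simples hk)
  rw [Set.image_singleton] at key
  have hfj : 0 < f (Q.root j) := (key hj).1.lt_of_ne' fun h ↦ hij ((key hj).2 h)
  rw [← Q.root_reflectionPerm]
  by_contra hneg
  obtain ⟨k, hk⟩ := exists_neg_root (Q := Q) (Q.reflectionPerm i j)
  have h1 : 0 < l (Q.root k) := by
    rw [hk, map_neg, neg_pos]
    exact (not_lt.1 hneg).lt_of_ne (hl _)
  have h2 := (key h1).1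
  rw [hk, Q.root_reflectionPerm, Q.reflection_apply, map_neg, map_sub, map_smul, hf i hi] at h2
  simp at h2
  linarith

/-- Induction on the value of `l`: a positive root off the simple lines pairs positively with some
simple root, and reflecting in that one lowers the value while conjugating the reflection.
Proportional roots have the same reflection, which settles the roots on simple lines and the
negative roots. -/
theorem reflection_mem_closure_simples (hl : ∀ i, l (Q.root i) ≠ 0) (j : ι) :
    Q.reflection j ∈ Subgroup.closure (Q.reflection '' simples Q l) := by
  have := Fintype.ofFinite ι
  have prop {i j : ι} (hi : i ∈ simples Q l) (h : Q.root j ∈ Submodule.span ℝ {Q.root i}) :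
      Q.reflection j ∈ Subgroup.closure (Q.reflection '' simples Q l) := by
    obtain ⟨c, hc⟩ := Submodule.mem_span_singleton.1 h
    have := mul_reflection_eq Q (u := 1) (fun _ _ ↦ rfl) hc.symm
    rw [one_mul, mul_one] at this
    rw [this]
    exact Subgroup.subset_closure ⟨i, hi, rfl⟩
  have pos (j : ι) (hj : 0 < l (Q.root j)) :
      Q.reflection j ∈ Subgroup.closure (Q.reflection '' simples Q l) := by
    induction j using (Finite.wellFounded_of_trans_of_irrefl
      (InvImage (· < ·) fun j ↦ l (Q.root j))).induction with
    | _ j ih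
    by_cases hs : ∃ i ∈ simples Q l, Q.root j ∈ Submodule.span ℝ {Q.root i}
    · obtain ⟨i, hi, h⟩ := hs
      exact prop hi h
    push Not at hs
    obtain ⟨i, hi, hij⟩ : ∃ i ∈ simples Q l, 0 < Q.pairing j i := by
      by_contra! hc
      -- If no simple root paired positively with `j`, the form of `j` with itself would be
      -- nonpositive.
      have h1 := nonneg_of_mem_closure (f := -Q.RootForm (Q.root j)) (t := Set.univ)
        (fun i hi ↦ ?_) (fun _ _ _ ↦ trivial) (root_mem_closure_simples hj)
      · have := rootForm_root_self_pos Q j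
        simp only [LinearMap.neg_apply] at h1
        linarith [h1.1]
      · have h2 := mul_form_eq_of_reflection (B := Q.RootForm)
          (s := (Q.reflection i : V →ₗ[ℝ] V)) (Q.rootForm_reflection_reflection_apply i)
          (Q.reflection_apply i) (by simp) (Q.root j)
        have h3 := rootForm_root_self_pos Q i
        rw [Q.root_coroot'_eq_pairing] at h2
        rw [LinearMap.neg_apply]
        nlinarith [hc i hi]
    have hli : 0 < l (Q.root i) := IsAddIndecomposable.baseOf_subset_pos _ _ hi
    have h1 := reflection_pos hl hi hj (hs i hi)
    rw [← Q.root_reflectionPerm] at h1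
    have h2 := ih (Q.reflectionPerm i j) (by
      change l (Q.root (Q.reflectionPerm i j)) < l (Q.root j)
      rw [Q.root_reflectionPerm, Q.reflection_apply_root, map_sub, map_smul, smul_eq_mul]
      nlinarith) h1
    have h3 := mul_reflection_eq Q (u := Q.reflection i)
      (Q.rootForm_reflection_reflection_apply i)
      (i := j) (j := Q.reflectionPerm i j) (c := 1) (by simp)
    have h4 := Subgroup.subset_closure (Set.mem_image_of_mem Q.reflection hi)
    rw [eq_inv_mul_of_mul_eq h3]
    exact mul_mem (inv_mem h4) (mul_mem h2 h4)
  by_cases hj : 0 < l (Q.root j)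
  · exact pos j hj
  · obtain ⟨k, hk⟩ := exists_neg_root (Q := Q) j
    have h1 := pos k (by rw [hk, map_neg, neg_pos]; exact (not_lt.1 hj).lt_of_ne (hl _))
    have := mul_reflection_eq Q (u := 1) (i := k) (j := j) (c := -1) (fun _ _ ↦ rfl) (by simp [hk])
    rw [one_mul, mul_one] at this
    rwa [← this]

omit [Finite ι] [Q.IsCrystallographic] in
theorem prod_reflection_root (m : List ι) (i : ι) :
    ∃ k, (m.map Q.reflection).prod (Q.root i) = Q.root k := by
  induction m with
  | nil => exact ⟨i, by simp⟩
  | cons j m ih =>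
    obtain ⟨k, hk⟩ := ih
    exact ⟨Q.reflectionPerm j k, by simp [hk]⟩

omit [Finite ι] [Q.IsCrystallographic] in
theorem rootForm_prod_reflection [Fintype ι] (m : List ι) (x y : V) :
    Q.RootForm ((m.map Q.reflection).prod x) ((m.map Q.reflection).prod y) = Q.RootForm x y := by
  induction m with
  | nil => simp
  | cons j m ih => simpa using ih

/-- The exchange condition. -/
theorem exists_shorter (hl : ∀ i, l (Q.root i) ≠ 0) {i : ι}
    (hi : i ∈ simples Q l) (m : List ι) (hm : ∀ j ∈ m, j ∈ simples Q l)
    (h : l ((m.map Q.reflection).prod (Q.root i)) < 0) :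
    ∃ m' : List ι, (∀ j ∈ m', j ∈ simples Q l) ∧ m'.length < m.length ∧
      (m.map Q.reflection).prod * Q.reflection i = (m'.map Q.reflection).prod := by
  have := Fintype.ofFinite ι
  induction m with
  | nil =>
    have hli : 0 < l (Q.root i) := IsAddIndecomposable.baseOf_subset_pos _ _ hi
    simp at h
    linarith
  | cons j m ih =>
    obtain ⟨k, hk⟩ := prod_reflection_root (Q := Q) m i
    have hj : j ∈ simples Q l := hm j (by simp)
    have hm' : ∀ j ∈ m, j ∈ simples Q l := fun j hj ↦ hm j (by simp [hj])
    rcases (hl k).lt_or_gt with hneg | hpos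
    · obtain ⟨m', h1, h2, h3⟩ := ih hm' (by rwa [hk])
      exact ⟨j :: m', by simpa using ⟨hj, h1⟩, by simpa using h2, by simp [mul_assoc, h3]⟩
    -- The letter `j` is where the root turns negative, so `k` lies on the line of `j`. Conjugating
    -- the reflection in `i` past the rest of the word then cancels `j`.
    · have hmem : Q.root k ∈ Submodule.span ℝ {Q.root j} := by
        by_contra hc
        have := reflection_pos hl hj hpos hc
        rw [List.map_cons, List.prod_cons, LinearEquiv.mul_apply, hk] at h
        linarith
      obtain ⟨c, hc⟩ := Submodule.mem_span_singleton.1 hmem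
      refine ⟨m, hm', by simp, ?_⟩
      have := mul_reflection_eq Q (rootForm_prod_reflection m) (hk.trans hc.symm)
      rw [List.map_cons, List.prod_cons, mul_assoc, this, ← mul_assoc, ← sq, Q.reflection_sq,
        one_mul]

/-- The Weyl group acts freely on positive systems. -/
theorem eq_one_of_pos (hl : ∀ i, l (Q.root i) ≠ 0) {g : V ≃ₗ[ℝ] V}
    (hg : g ∈ Subgroup.closure (Set.range Q.reflection))
    (hpos : ∀ i, 0 < l (Q.root i) → 0 < l (g (Q.root i))) : g = 1 := by
  have key (n : ℕ) : ∀ m : List ι, m.length = n → (∀ j ∈ m, j ∈ simples Q l) →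
      (∀ i, 0 < l (Q.root i) → 0 < l ((m.map Q.reflection).prod (Q.root i))) →
      (m.map Q.reflection).prod = 1 := by
    induction n using Nat.strong_induction_on with
    | _ n ih
    intro m hmn hm hp
    rcases m.eq_nil_or_concat with rfl | ⟨m, i, rfl⟩
    · simp
    rw [List.concat_eq_append] at *
    have hi : i ∈ simples Q l := hm i (by simp)
    have h1 := hp i (IsAddIndecomposable.baseOf_subset_pos _ _ hi)
    simp only [List.map_append, List.prod_append, List.map_cons, List.map_nil, List.prod_cons,
      List.prod_nil, mul_one] at h1 hp ⊢
    -- The last letter `i` negates its own root, so positivity of the full word there means that the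
    -- prefix `m` makes this root negative.
    obtain ⟨m', h2, h3, h4⟩ := exists_shorter hl hi m (fun j hj ↦ hm j (by simp [hj]))
      (by simpa using h1)
    rw [h4] at hp ⊢
    exact ih _ (by simp at hmn; omega) m' rfl h2 hp
  have h1 : g ∈ Subgroup.closure (Q.reflection '' simples Q l) :=
    (Subgroup.closure_le _).2 (Set.range_subset_iff.2 (reflection_mem_closure_simples hl)) hg
  rw [← Subgroup.mem_toSubmonoid, Subgroup.closure_toSubmonoid] at h1
  obtain ⟨L, hL, rfl⟩ := Submonoid.exists_list_of_mem_closure h1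
  obtain ⟨m, hm, rfl⟩ : ∃ m : List ι, (∀ j ∈ m, j ∈ simples Q l) ∧ m.map Q.reflection = L := by
    clear hpos hg h1
    induction L with
    | nil => exact ⟨[], by simp⟩
    | cons x L ih =>
      obtain ⟨m, hm, rfl⟩ := ih fun x hx ↦ hL x (by simp [hx])
      obtain ⟨i, hi, rfl⟩ : ∃ i ∈ simples Q l, Q.reflection i = x := by
        rcases hL x (by simp) with h | ⟨i, hi, h⟩
        · exact h
        · exact ⟨i, hi, by rw [← inv_inv x, ← h, Q.reflection_inv]⟩
      exact ⟨i :: m, by simpa using ⟨hi, hm⟩, by simp⟩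
  exact key _ m rfl hm hpos

omit [Q.IsCrystallographic] in
/-- An element of the Weyl group that fixes all roots is trivial. -/
theorem weylGroup_eq_one_of_smul (w : Q.weylGroup) (hw : ∀ i : ι, w • Q.root i = Q.root i) :
    w = 1 := by
  have := Fintype.ofFinite ι
  have hB (x y : V) : Q.RootForm (w • x) (w • y) = Q.RootForm x y :=
    RootPairing.InvariantForm.apply_weylGroup_smul Q (B := Q.toInvariantForm) w x y
  have hspan : ∀ u : Q.weylGroup, ∀ x : V, u • x - x ∈ Q.rootSpan ℝ := by
    rintro ⟨u, hu⟩
    induction hu using RootPairing.weylGroup.induction with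
    | one => intro x; change (1 : Q.weylGroup) • x - x ∈ _; simp
    | mem i =>
      intro x
      change Q.reflection i x - x ∈ _
      rw [Q.reflection_apply, sub_sub_cancel_left, neg_mem_iff]
      exact Submodule.smul_mem _ _ (Submodule.subset_span ⟨i, rfl⟩)
    | mul u v hu hv ihu ihv =>
      intro x
      have := add_mem (ihu ((⟨v, hv⟩ : Q.weylGroup) • x)) (ihv x)
      rwa [sub_add_sub_cancel, smul_smul] at this
  apply Subtype.ext
  apply RootPairing.Equiv.weightHom_injective Q
  refine LinearEquiv.ext fun x ↦ ?_
  change w • x = x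
  rw [← sub_eq_zero]
  -- The difference `w • x - x` lies in the root span and is killed by all coroots, hence lies in
  -- the radical of `RootForm`; the two meet only in zero.
  refine Submodule.disjoint_def.1 Q.disjoint_rootSpan_ker_rootForm _ (hspan w x) ?_
  have hco (i : ι) : Q.coroot' i (w • x - x) = 0 := by
    have h2 := mul_form_eq_of_reflection (B := Q.RootForm)
      (s := (Q.reflection i : V →ₗ[ℝ] V)) (Q.rootForm_reflection_reflection_apply i)
      (Q.reflection_apply i) (by simp) (w • x - x)
    have h3 := hB x (Q.root i)
    rw [hw] at h3
    rw [map_sub Q.RootForm, LinearMap.sub_apply, h3, sub_self, mul_zero] at h2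
    exact (mul_eq_zero.1 h2).resolve_right (rootForm_root_self_pos Q i).ne'
  rw [LinearMap.mem_ker]
  ext y
  rw [Q.rootForm_apply_apply]
  simp only [hco, zero_mul, Finset.sum_const_zero, LinearMap.zero_apply]

theorem finite_weylGroup (Q : RootPairing ι ℝ V V') [Q.IsCrystallographic] :
    Finite Q.weylGroup := by
  refine Finite.of_injective Q.weylGroupToPerm ((injective_iff_map_eq_one _).2 fun w hw ↦ ?_)
  refine weylGroup_eq_one_of_smul w fun i ↦ ?_
  rw [Q.weylGroup_apply_root, hw]
  rfl

end Free

/-! ### Levi subgroups, height functionals and longest elements -/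

section Levi

variable {ι V V' : Type*} [AddCommGroup V] [Module ℝ V] [AddCommGroup V'] [Module ℝ V']
  {P : RootPairing ι ℝ V V'} (Δ : SimpleRoots P) {θ : Set ι}

theorem exists_height : ∃ l : Dual ℝ V, ∀ i, l (P.root i) ≠ 0 ∧ (Δ.IsPos i ↔ 0 < l (P.root i)) := by
  obtain ⟨l, hl⟩ := exists_dual_apply_eq Δ.linearIndepOn_root 1
  have key {i : ι} {x : V} (hi : P.root i = x ∨ P.root i = -x)
      (hx : x ∈ AddSubmonoid.closure (P.root '' Δ.support)) : 0 < l x := by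
    have h := nonneg_of_mem_closure (f := l) (t := ∅) (fun i hi ↦ by rw [hl i hi]; simp)
      (fun i hi h ↦ by rw [hl i hi] at h; simp at h) hx
    refine h.1.lt_of_ne' fun h0 ↦ P.ne_zero i ?_
    have := h.2 h0
    simp only [Set.image_empty, Submodule.span_empty, Submodule.mem_bot] at this
    simpa [this] using hi
  refine ⟨l, fun i ↦ ?_⟩
  rcases Δ.root_mem_or_neg_mem i with h | h
  · have := key (.inl rfl) h
    exact ⟨this.ne', fun _ ↦ this, fun _ ↦ h⟩
  · have := key (i := i) (.inr (by simp)) h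
    rw [map_neg, neg_pos] at this
    exact ⟨this.ne, fun h ↦ key (.inl rfl) h, fun h ↦ absurd this h.not_gt⟩

/-- A functional that is positive exactly at the positive roots. -/
def height : Dual ℝ V := (exists_height Δ).choose

theorem height_ne_zero (i : ι) : height Δ (P.root i) ≠ 0 := ((exists_height Δ).choose_spec i).1

theorem isPos_iff (i : ι) : Δ.IsPos i ↔ 0 < height Δ (P.root i) :=
  ((exists_height Δ).choose_spec i).2

/-- The functional that is `0` on `θ` and `1` on the other simple roots descends to the quotient,
and among sums of simple roots it vanishes only on the span of `θ`. Hence the sign of a relative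
root does not depend on the root chosen above it. -/
theorem exists_relHeight (hθ : θ ⊆ Δ.support) : ∃ l : Dual ℝ (RelSpace P θ),
    ∀ i, P.root i ∉ leviSpan P θ → l ((leviSpan P θ).mkQ (P.root i)) ≠ 0 ∧
      (Δ.IsPos i ↔ 0 < l ((leviSpan P θ).mkQ (P.root i))) := by
  classical
  obtain ⟨l, hl⟩ := exists_dual_apply_eq Δ.linearIndepOn_root fun i ↦ if i ∈ θ then 0 else 1
  have hle : leviSpan P θ ≤ LinearMap.ker l := by
    rw [leviSpan, Submodule.span_le]
    rintro _ ⟨i, hi, rfl⟩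
    simp [hl i (hθ hi), hi]
  have key {x : V} (hx : x ∈ AddSubmonoid.closure (P.root '' Δ.support))
      (hm : x ∉ leviSpan P θ) : 0 < l x := by
    have h := nonneg_of_mem_closure (f := l) (t := θ)
      (fun i hi ↦ by rw [hl i hi]; split_ifs <;> simp)
      (fun i hi h ↦ by rw [hl i hi] at h; simpa using h) hx
    exact h.1.lt_of_ne' fun h0 ↦ hm (h.2 h0)
  refine ⟨(leviSpan P θ).liftQ l hle, fun i hi ↦ ?_⟩
  rw [Submodule.mkQ_apply, Submodule.liftQ_apply]
  rcases Δ.root_mem_or_neg_mem i with h | h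
  · have := key h hi
    exact ⟨this.ne', fun _ ↦ this, fun _ ↦ h⟩
  · have := key h (by simpa using hi)
    rw [map_neg, neg_pos] at this
    exact ⟨this.ne, fun h ↦ key h hi, fun h ↦ absurd this h.not_gt⟩

/-- A functional on `𝔞_M^*` that is positive exactly at the positive relative roots. -/
def relHeight (hθ : θ ⊆ Δ.support) : Dual ℝ (RelSpace P θ) := (exists_relHeight Δ hθ).choose

theorem relHeight_ne_zero (hθ : θ ⊆ Δ.support) {β : RelSpace P θ} (hβ : β ∈ relRoots P θ) :
    relHeight Δ hθ β ≠ 0 := by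
  obtain ⟨h0, i, rfl⟩ := hβ
  exact ((exists_relHeight Δ hθ).choose_spec i fun h ↦ h0 (by simpa using h)).1

theorem isPos_iff_relHeight (hθ : θ ⊆ Δ.support) {i : ι} (hi : P.root i ∉ leviSpan P θ) :
    Δ.IsPos i ↔ 0 < relHeight Δ hθ ((leviSpan P θ).mkQ (P.root i)) :=
  ((exists_relHeight Δ hθ).choose_spec i hi).2

theorem isRelPos_iff (hθ : θ ⊆ Δ.support) {β : RelSpace P θ} (hβ : β ∈ relRoots P θ) :
    IsRelPos Δ θ β ↔ 0 < relHeight Δ hθ β := by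
  have hmem {i : ι} (h : (leviSpan P θ).mkQ (P.root i) = β) : P.root i ∉ leviSpan P θ :=
    fun hi ↦ hβ.1 (by rw [← h]; simpa using hi)
  constructor
  · rintro ⟨-, i, hi, rfl⟩
    exact (isPos_iff_relHeight Δ hθ (hmem rfl)).1 hi
  · intro h
    obtain ⟨h0, i, rfl⟩ := hβ
    exact ⟨h0, i, (isPos_iff_relHeight Δ hθ (hmem rfl)).2 h, rfl⟩

variable (P) in
/-- The root pairing formed by the roots of a semistandard Levi subgroup. -/
def leviPairing (S : Submodule ℝ V) : RootPairing (leviRoots P S) ℝ V V' where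
  toLinearMap := P.toLinearMap
  root := (Function.Embedding.subtype _).trans P.root
  coroot := (Function.Embedding.subtype _).trans P.coroot
  root_coroot_two i := P.root_coroot_two i
  reflectionPerm i := (P.reflectionPerm i).subtypeEquiv fun j ↦ by
    change P.root j ∈ S ↔ P.root _ ∈ S
    rw [P.root_reflectionPerm, P.reflection_apply]
    exact (S.sub_mem_iff_left (S.smul_mem _ i.2)).symm
  reflectionPerm_root i j := P.reflectionPerm_root i j
  reflectionPerm_coroot i j := P.reflectionPerm_coroot i j

instance (S : Submodule ℝ V) [P.IsCrystallographic] : (leviPairing P S).IsCrystallographic where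
  exists_value i j := P.exists_value (i : ι) (j : ι)

theorem ofIdx_smul_sub_mem {S : Submodule ℝ V} {i : ι} (hi : i ∈ leviRoots P S) (x : V) :
    RootPairing.weylGroup.ofIdx P i • x - x ∈ S := by
  change P.reflection i x - x ∈ _
  rw [P.reflection_apply, sub_sub_cancel_left, neg_mem_iff]
  exact Submodule.smul_mem _ _ hi

theorem ofIdx_inv (i : ι) :
    (RootPairing.weylGroup.ofIdx P i)⁻¹ = RootPairing.weylGroup.ofIdx P i :=
  Subtype.ext (RootPairing.Equiv.reflection_inv P i)

/-- `W^L` acts trivially modulo the subspace attached to `L`. -/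
theorem smul_sub_mem {S : Submodule ℝ V} {u : P.weylGroup} (hu : u ∈ leviWeyl P S) (x : V) :
    u • x - x ∈ S := by
  induction hu using Subgroup.closure_induction'' generalizing x with
  | one => simp
  | mem u hu =>
    obtain ⟨i, hi, rfl⟩ := hu
    exact ofIdx_smul_sub_mem hi x
  | inv_mem u hu =>
    obtain ⟨i, hi, rfl⟩ := hu
    rw [ofIdx_inv]
    exact ofIdx_smul_sub_mem hi x
  | mul u v _ _ hu hv =>
    have := add_mem (hu (v • x)) (hv x)
    rwa [sub_add_sub_cancel, smul_smul] at this

theorem smul_mem_leviRoots_iff {S : Submodule ℝ V} {u : P.weylGroup} (hu : u ∈ leviWeyl P S)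
    {i : ι} : u • i ∈ leviRoots P S ↔ i ∈ leviRoots P S := by
  have := smul_sub_mem hu (P.root i)
  rw [← root_smul] at this
  exact ⟨fun h ↦ (S.sub_mem_iff_right h).1 this, fun h ↦ (S.sub_mem_iff_left h).1 this⟩

theorem leviWeyl_mono {S T : Submodule ℝ V} (h : S ≤ T) : leviWeyl P S ≤ leviWeyl P T :=
  Subgroup.closure_mono (Set.image_mono fun _ hi ↦ h hi)

theorem weightHom_mem_closure {S : Submodule ℝ V} {u : P.weylGroup} (hu : u ∈ leviWeyl P S) :
    RootPairing.Equiv.weightHom P u ∈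
      Subgroup.closure (Set.range (leviPairing P S).reflection) := by
  suffices leviWeyl P S ≤ (Subgroup.closure (Set.range (leviPairing P S).reflection)).comap
    ((RootPairing.Equiv.weightHom P).comp P.weylGroup.subtype) from this hu
  rw [leviWeyl, Subgroup.closure_le]
  rintro _ ⟨i, hi, rfl⟩
  refine Subgroup.subset_closure ⟨⟨i, hi⟩, ?_⟩
  ext x
  rfl

variable [Finite ι]

variable [P.IsCrystallographic]

/-- `W^L` acts freely on the positive systems of `L`. -/
theorem leviWeyl_eq_one_of_pos {S : Submodule ℝ V} {u : P.weylGroup} (hu : u ∈ leviWeyl P S)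
    (h : ∀ i ∈ leviRoots P S, 0 < height Δ (P.root i) → 0 < height Δ (P.root (u • i))) :
    u = 1 := by
  apply Subtype.ext
  apply RootPairing.Equiv.weightHom_injective P
  rw [OneMemClass.coe_one, map_one]
  refine eq_one_of_pos (Q := leviPairing P S) (l := height Δ) (fun i ↦ height_ne_zero Δ i)
    (weightHom_mem_closure hu) fun i hi ↦ ?_
  have := h i i.2 hi
  rwa [root_smul] at this

omit [Finite ι] [P.IsCrystallographic] in
theorem finiteDimensional_of_rootPairing (P : RootPairing ι ℝ V V') : FiniteDimensional ℝ V :=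
  have : IsReflexive ℝ V := .of_isPerfPair P.toLinearMap
  inferInstance

theorem exists_leviWeyl_dominant (S : Submodule ℝ V) (l μ : Dual ℝ V) :
    ∃ h ∈ leviWeyl P S, ∀ i ∈ leviRoots P S, 0 < l (P.root i) → 0 ≤ μ (P.root (h • i)) := by
  have := finiteDimensional_of_rootPairing P
  have := finite_weylGroup P
  obtain ⟨h, hh, H⟩ := exists_dominant P.weylGroupRootRep (leviWeyl P S)
    (P.root '' leviRoots P S) (by
      rintro _ ⟨i, hi, rfl⟩
      exact ⟨_, Subgroup.subset_closure ⟨i, hi, rfl⟩, P.coroot' i, by simp,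
        fun x ↦ P.reflection_apply i x⟩) l μ
  refine ⟨h, hh, fun i hi hl ↦ ?_⟩
  rw [root_smul]
  exact H _ ⟨i, hi, rfl⟩ hl

omit [P.IsCrystallographic] in
theorem longest_mem (S : Submodule ℝ V) : longest Δ S ∈ leviWeyl P S :=
  (exists_isLongest Δ S).choose_spec.1

/-- Dominance for `-height` yields some `u` in `W^L` negating every positive root of `L`. Maximality
of the length makes the longest element negate all reduced ones as well; a root that is twice
another follows from its half. -/
theorem height_longest_neg {S : Submodule ℝ V} {i : ι} (hi : i ∈ leviRoots P S)
    (h : 0 < height Δ (P.root i)) : height Δ (P.root (longest Δ S • i)) < 0 := by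
  obtain ⟨u, hu, H⟩ := exists_leviWeyl_dominant (P := P) S (height Δ) (-height Δ)
  have hle := (exists_isLongest Δ S).choose_spec.2 u hu
  change leviLength Δ S u ≤ leviLength Δ S (longest Δ S) at hle
  have hsub : {i ∈ leviRoots P S | (∀ j, P.root i ≠ (2 : ℝ) • P.root j) ∧ Δ.IsPos i ∧
      ¬ Δ.IsPos (longest Δ S • i)} ⊆ {i ∈ leviRoots P S | (∀ j, P.root i ≠ (2 : ℝ) • P.root j) ∧
      Δ.IsPos i ∧ ¬ Δ.IsPos (u • i)} := by
    rintro i ⟨h1, h2, h3, -⟩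
    refine ⟨h1, h2, h3, ?_⟩
    rw [isPos_iff] at h3 ⊢
    have := H i h1 h3
    rw [LinearMap.neg_apply] at this
    linarith
  have heq := Set.eq_of_subset_of_ncard_le hsub hle
  induction i using (Finite.wellFounded_of_trans_of_irrefl
    (InvImage (· < ·) fun j ↦ height Δ (P.root j))).induction with
  | _ i ih
  by_cases hred : ∀ j, P.root i ≠ (2 : ℝ) • P.root j
  · have hmem : i ∈ {i ∈ leviRoots P S | (∀ j, P.root i ≠ (2 : ℝ) • P.root j) ∧
        Δ.IsPos i ∧ ¬ Δ.IsPos (u • i)} := by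
      refine ⟨hi, hred, (isPos_iff Δ i).2 h, ?_⟩
      rw [isPos_iff]
      have := H i hi h
      rw [LinearMap.neg_apply] at this
      linarith
    rw [← heq] at hmem
    have := hmem.2.2.2
    rw [isPos_iff] at this
    exact (not_lt.1 this).lt_of_ne (height_ne_zero Δ _)
  · push Not at hred
    obtain ⟨j, hj⟩ := hred
    have hlj : height Δ (P.root i) = 2 * height Δ (P.root j) := by rw [hj]; simp
    have hjS : j ∈ leviRoots P S := by
      have : (2 : ℝ) • P.root j ∈ S := hj ▸ hi
      exact (S.smul_mem_iff two_ne_zero).1 this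
    have := ih j (by change height Δ (P.root j) < height Δ (P.root i); linarith) hjS (by linarith)
    rw [root_smul, hj, smul_comm, map_smul, ← root_smul, smul_eq_mul]
    linarith

theorem height_longest_neg_iff {S : Submodule ℝ V} {i : ι} (hi : i ∈ leviRoots P S) :
    height Δ (P.root (longest Δ S • i)) < 0 ↔ 0 < height Δ (P.root i) := by
  refine ⟨fun h ↦ ?_, height_longest_neg Δ hi⟩
  by_contra hc
  obtain ⟨j, hj⟩ := exists_neg_root (Q := P) i
  have h1 := height_longest_neg Δ (S := S) (i := j) (by simpa [leviRoots, hj] using hi)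
    (by rw [hj, map_neg, neg_pos]; exact (not_lt.1 hc).lt_of_ne (height_ne_zero Δ i))
  rw [root_smul, hj, smul_neg, map_neg, ← root_smul] at h1
  linarith

theorem height_longest_pos_iff {S : Submodule ℝ V} {i : ι} (hi : i ∈ leviRoots P S) :
    0 < height Δ (P.root (longest Δ S • i)) ↔ height Δ (P.root i) < 0 := by
  have h1 := height_ne_zero Δ (longest Δ S • i)
  have h2 := height_ne_zero Δ i
  rw [← not_iff_not, not_lt, not_lt, le_iff_lt_or_eq, le_iff_lt_or_eq,
    height_longest_neg_iff Δ hi]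
  simp [h1, h2.symm]

end Levi

/-! ### Relative roots and relative reflections -/

section Relative

variable {ι V V' : Type*} [AddCommGroup V] [Module ℝ V] [AddCommGroup V'] [Module ℝ V']
  {P : RootPairing ι ℝ V V'} (Δ : SimpleRoots P) {θ : Set ι}

theorem mem_leviStabilizer_iff {w : P.weylGroup} : w ∈ leviStabilizer P θ ↔
    ∀ i, P.root (w • i) ∈ leviSpan P θ ↔ P.root i ∈ leviSpan P θ := by
  refine ⟨mem_leviStabilizer, fun h ↦ ?_⟩
  refine MulAction.mem_stabilizer_iff.2 (Set.ext fun i ↦ ?_)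
  rw [Set.mem_smul_set_iff_inv_smul_mem]
  have := h (w⁻¹ • i)
  rw [smul_inv_smul] at this
  exact this.symm

theorem leviWeyl_le_leviStabilizer : leviWeyl P (leviSpan P θ) ≤ leviStabilizer P θ :=
  fun _ hu ↦ mem_leviStabilizer_iff.2 fun _ ↦ smul_mem_leviRoots_iff hu

theorem mkQ_smul_of_mem {u : P.weylGroup} (hu : u ∈ leviWeyl P (leviSpan P θ)) (x : V) :
    (leviSpan P θ).mkQ (u • x) = (leviSpan P θ).mkQ x :=
  (Submodule.Quotient.eq _).2 (smul_sub_mem hu x)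

theorem stabilizerRep_mkQ (w : leviStabilizer P θ) (x : V) :
    stabilizerRep P θ w ((leviSpan P θ).mkQ x) = (leviSpan P θ).mkQ ((w : P.weylGroup) • x) :=
  rfl

theorem leviSpan_le_corankOneSpan (β : RelSpace P θ) : leviSpan P θ ≤ corankOneSpan β := by
  intro x hx
  rw [corankOneSpan, Submodule.mem_comap, Submodule.mkQ_apply,
    (Submodule.Quotient.mk_eq_zero _).2 hx]
  exact zero_mem _

theorem mem_corankOneSpan {β : RelSpace P θ} {x : V} :
    x ∈ corankOneSpan β ↔ ∃ c : ℝ, c • β = (leviSpan P θ).mkQ x := by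
  rw [corankOneSpan, Submodule.mem_comap, Submodule.mem_span_singleton]

theorem mkQ_ne_zero {x : V} : (leviSpan P θ).mkQ x ≠ 0 ↔ x ∉ leviSpan P θ := by
  simp

theorem neg_mem_relRoots {β : RelSpace P θ} (h : β ∈ relRoots P θ) : -β ∈ relRoots P θ := by
  obtain ⟨h0, i, rfl⟩ := h
  obtain ⟨j, hj⟩ := exists_neg_root (Q := P) i
  exact ⟨neg_ne_zero.2 h0, j, by rw [hj, map_neg]⟩

theorem eq_or_eq_neg_of_zsmul {β γ : RelSpace P θ} (hβ : β ∈ reducedRelRoots P θ)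
    (hγ : γ ∈ relRoots P θ) {m : ℤ} (h : β = m • γ) : β = γ ∨ β = -γ := by
  obtain ⟨n, rfl | rfl⟩ := m.eq_nat_or_neg
  · left
    rw [natCast_zsmul] at h
    rcases Nat.lt_or_ge n 2 with hn | hn
    · interval_cases n
      · exact absurd (by simpa using h) hβ.1.1
      · simpa using h
    · exact absurd h (hβ.2 _ hγ n hn)
  · right
    rw [neg_smul, natCast_zsmul, ← smul_neg] at h
    rcases Nat.lt_or_ge n 2 with hn | hn
    · interval_cases n
      · exact absurd (by simpa using h) hβ.1.1
      · simpa using h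
    · exact absurd h (hβ.2 _ (neg_mem_relRoots hγ) n hn)

theorem stabilizerRep_mem_relRoots (w : leviStabilizer P θ) {β : RelSpace P θ}
    (hβ : β ∈ relRoots P θ) : stabilizerRep P θ w β ∈ relRoots P θ := by
  obtain ⟨h0, i, rfl⟩ := hβ
  refine ⟨?_, (w : P.weylGroup) • i, by rw [stabilizerRep_mkQ, root_smul]⟩
  rw [stabilizerRep_mkQ, ← root_smul, mkQ_ne_zero, mem_leviStabilizer w.2]
  exact mkQ_ne_zero.1 h0

theorem stabilizerRep_inv_apply (w : leviStabilizer P θ) (x : RelSpace P θ) :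
    stabilizerRep P θ w⁻¹ (stabilizerRep P θ w x) = x := by
  rw [← End.mul_apply, ← map_mul, inv_mul_cancel, map_one, End.one_apply]

theorem stabilizerRep_mem_reducedRelRoots (w : leviStabilizer P θ) {β : RelSpace P θ}
    (hβ : β ∈ reducedRelRoots P θ) : stabilizerRep P θ w β ∈ reducedRelRoots P θ := by
  refine ⟨stabilizerRep_mem_relRoots w hβ.1, fun γ hγ n hn h ↦ ?_⟩
  refine hβ.2 _ (stabilizerRep_mem_relRoots w⁻¹ hγ) n hn ?_
  rw [← map_nsmul, ← h, stabilizerRep_inv_apply]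

theorem conj_mem_leviWeyl (w : leviStabilizer P θ) {β : RelSpace P θ} {u : P.weylGroup}
    (hu : u ∈ leviWeyl P (corankOneSpan β)) :
    (w : P.weylGroup) * u * (w : P.weylGroup)⁻¹ ∈
      leviWeyl P (corankOneSpan (stabilizerRep P θ w β)) := by
  suffices leviWeyl P (corankOneSpan β) ≤
      (leviWeyl P (corankOneSpan (stabilizerRep P θ w β))).comap
        (MulAut.conj (w : P.weylGroup)).toMonoidHom from this hu
  conv_lhs => rw [leviWeyl]
  rw [Subgroup.closure_le]
  rintro _ ⟨i, hi, rfl⟩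
  change (w : P.weylGroup) * RootPairing.weylGroup.ofIdx P i * (w : P.weylGroup)⁻¹ ∈
    leviWeyl P (corankOneSpan (stabilizerRep P θ w β))
  rw [conj_ofIdx]
  refine Subgroup.subset_closure ⟨_, ?_, rfl⟩
  obtain ⟨c, hc⟩ := mem_corankOneSpan.1 hi
  refine mem_corankOneSpan.2 ⟨c, ?_⟩
  rw [← map_smul, hc, root_smul, stabilizerRep_mkQ]

/-- Elements of `W^L` move roots by integral combinations of roots of `L`. -/
theorem smul_root_sub_mem_closure [P.IsCrystallographic] {S : Submodule ℝ V} {u : P.weylGroup}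
    (hu : u ∈ leviWeyl P S) (i : ι) :
    u • P.root i - P.root i ∈ AddSubgroup.closure (P.root '' leviRoots P S) := by
  have key {j : ι} (hj : j ∈ leviRoots P S) (i : ι) :
      RootPairing.weylGroup.ofIdx P j • P.root i - P.root i ∈
        AddSubgroup.closure (P.root '' leviRoots P S) := by
    change P.reflection j (P.root i) - P.root i ∈ _
    obtain ⟨m, hm⟩ := P.exists_value (S := ℤ) i j
    rw [P.reflection_apply_root, sub_sub_cancel_left, neg_mem_iff, ← hm, algebraMap_int_eq,
      Int.coe_castRingHom, Int.cast_smul_eq_zsmul]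
    exact zsmul_mem (AddSubgroup.subset_closure (Set.mem_image_of_mem _ hj)) m
  induction hu using Subgroup.closure_induction'' generalizing i with
  | one => simp
  | mem u hu =>
    obtain ⟨j, hj, rfl⟩ := hu
    exact key hj i
  | inv_mem u hu =>
    obtain ⟨j, hj, rfl⟩ := hu
    rw [ofIdx_inv]
    exact key hj i
  | mul u v _ _ hu hv =>
    have := add_mem (hu (v • i)) (hv i)
    rwa [root_smul, sub_add_sub_cancel, smul_smul] at this

variable [Finite ι] [P.IsCrystallographic]

instance finite_leviStabilizer : Finite (leviStabilizer P θ) :=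
  have := finite_weylGroup P
  inferInstance

instance finiteDimensional_relSpace : FiniteDimensional ℝ (RelSpace P θ) :=
  have := finiteDimensional_of_rootPairing P
  inferInstance

omit [P.IsCrystallographic] in
theorem relReflection_mem (β : RelSpace P θ) :
    relReflection Δ β ∈ leviWeyl P (corankOneSpan β) :=
  mul_mem (longest_mem Δ _) (leviWeyl_mono (leviSpan_le_corankOneSpan β) (longest_mem Δ _))

/-- Any root whose restriction is a multiple of a reduced relative root restricts to an integral
multiple of it. -/
theorem exists_zsmul_of_mem_corankOneSpan (hθ : θ ⊆ Δ.support) {β : RelSpace P θ}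
    (hβ : β ∈ reducedRelRoots P θ) {i : ι} (hi : i ∈ leviRoots P (corankOneSpan β)) :
    ∃ m : ℤ, (leviSpan P θ).mkQ (P.root i) = m • β := by
  classical
  set Q := leviPairing P (corankOneSpan β) with hQ
  have hroot (j : leviRoots P (corankOneSpan β)) : Q.root j = P.root j := rfl
  set D := simples Q (height Δ) with hD
  have hl (j) : height Δ (Q.root j) ≠ 0 := height_ne_zero Δ j
  have hDpos {j} (hj : j ∈ D) : 0 < height Δ (P.root j) :=
    IsAddIndecomposable.baseOf_subset_pos _ _ hj
  set t : Set (leviRoots P (corankOneSpan β)) := {j | P.root j ∈ leviSpan P θ} with ht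
  -- The simple roots of `M_β` lying in `M` already span `leviSpan P θ`: the relative height is
  -- nonnegative on `D` and vanishes there exactly on `t`, while it is zero on `θ`.
  have hspan : leviSpan P θ ≤ Submodule.span ℝ (Q.root '' (D ∩ t)) := by
    rw [leviSpan, Submodule.span_le]
    rintro _ ⟨k, hk, rfl⟩
    have hkM : P.root k ∈ leviSpan P θ := Submodule.subset_span ⟨k, hk, rfl⟩
    let k' : leviRoots P (corankOneSpan β) := ⟨k, leviSpan_le_corankOneSpan β hkM⟩
    have hpos : 0 < height Δ (Q.root k') :=
      (isPos_iff Δ k).1 (AddSubmonoid.subset_closure ⟨k, hθ hk, rfl⟩)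
    refine (nonneg_of_mem_closure (f := relHeight Δ hθ ∘ₗ (leviSpan P θ).mkQ) (s := D) ?_ ?_
      (root_mem_closure_simples hpos)).2 ?_
    · intro j hj
      by_cases hjM : P.root j ∈ leviSpan P θ
      · simp [hroot, (Submodule.Quotient.mk_eq_zero _).2 hjM]
      · exact ((isPos_iff_relHeight Δ hθ hjM).1 ((isPos_iff Δ _).2 (hDpos hj))).le
    · intro j hj h0
      refine ⟨hj, ?_⟩
      by_contra hjM
      exact ((isPos_iff_relHeight Δ hθ hjM).1 ((isPos_iff Δ _).2 (hDpos hj))).ne' h0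
    · change relHeight Δ hθ ((leviSpan P θ).mkQ (P.root k)) = 0
      rw [Submodule.mkQ_apply, (Submodule.Quotient.mk_eq_zero _).2 hkM, map_zero]
  -- Two simple roots outside `M` restrict to multiples of `β`, so a nontrivial combination of them
  -- lies in the span of `D ∩ t`, against linear independence.
  have huniq {a b} (ha : a ∈ D) (hat : a ∉ t) (hb : b ∈ D) (hbt : b ∉ t) : a = b := by
    by_contra hne
    obtain ⟨c, hc⟩ := mem_corankOneSpan.1 a.2
    obtain ⟨d, hd⟩ := mem_corankOneSpan.1 b.2
    have hd0 : d ≠ 0 := by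
      rintro rfl
      rw [zero_smul] at hd
      exact mkQ_ne_zero.2 hbt hd.symm
    obtain ⟨e, he⟩ := exists_dual_apply_eq (Q.linearIndepOn_root_baseOf' (height Δ) hl)
      (fun j ↦ if j = a then 1 else 0)
    have hle : Submodule.span ℝ (Q.root '' (D ∩ t)) ≤ LinearMap.ker e := by
      rw [Submodule.span_le]
      rintro _ ⟨j, ⟨hj, hjt⟩, rfl⟩
      have : j ≠ a := by rintro rfl; exact hat hjt
      simp [he j hj, this]
    have hx : d • Q.root a - c • Q.root b ∈ leviSpan P θ := by
      rw [← Submodule.Quotient.mk_eq_zero, ← Submodule.mkQ_apply, map_sub, map_smul, map_smul,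
        hroot, hroot, ← hc, ← hd, smul_comm, sub_self]
    have := hle (hspan hx)
    rw [LinearMap.mem_ker, map_sub, map_smul, map_smul, he a ha, he b hb] at this
    simp [Ne.symm hne] at this
    exact hd0 this
  obtain ⟨γ, hγ, hDγ⟩ : ∃ γ, (γ = 0 ∨ γ ∈ relRoots P θ) ∧ ∀ j ∈ D,
      (leviSpan P θ).mkQ (P.root j) = 0 ∨ (leviSpan P θ).mkQ (P.root j) = γ := by
    by_cases hex : ∃ a ∈ D, a ∉ t
    · obtain ⟨a, ha, hat⟩ := hex
      refine ⟨_, .inr ⟨mkQ_ne_zero.2 hat, a, rfl⟩, fun j hj ↦ ?_⟩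
      by_cases hjt : j ∈ t
      · exact .inl ((Submodule.Quotient.mk_eq_zero _).2 hjt)
      · exact .inr (by rw [huniq hj hjt ha hat])
    · push Not at hex
      exact ⟨0, .inl rfl, fun j hj ↦ .inl ((Submodule.Quotient.mk_eq_zero _).2 (hex j hj))⟩
  have hcl {x : V} (hx : x ∈ AddSubmonoid.closure (Q.root '' D)) :
      (leviSpan P θ).mkQ x ∈ AddSubgroup.zmultiples γ := by
    induction hx using AddSubmonoid.closure_induction with
    | mem x hx =>
      obtain ⟨j, hj, rfl⟩ := hx
      rcases hDγ j hj with h | h <;> rw [hroot, h]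
      · exact zero_mem _
      · exact AddSubgroup.mem_zmultiples γ
    | zero => simp
    | add x y _ _ hx hy => rw [map_add]; exact add_mem hx hy
  have hall {j : ι} (hj : j ∈ leviRoots P (corankOneSpan β)) :
      (leviSpan P θ).mkQ (P.root j) ∈ AddSubgroup.zmultiples γ := by
    by_cases hpos : 0 < height Δ (P.root j)
    · exact hcl (root_mem_closure_simples (Q := Q) (i := ⟨j, hj⟩) hpos)
    · obtain ⟨k, hk⟩ := exists_neg_root (Q := P) j
      have hkS : k ∈ leviRoots P (corankOneSpan β) := by
        change P.root k ∈ corankOneSpan β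
        rw [hk]
        exact neg_mem hj
      have := hcl (root_mem_closure_simples (Q := Q) (l := height Δ) (i := ⟨k, hkS⟩) (by
        change 0 < height Δ (P.root k)
        rw [hk, map_neg, neg_pos]
        exact (not_lt.1 hpos).lt_of_ne (height_ne_zero Δ j)))
      rw [hroot, hk, map_neg, neg_mem_iff] at this
      exact this
  obtain ⟨i₀, hi₀⟩ := hβ.1.2
  obtain ⟨m₀, hm₀⟩ := AddSubgroup.mem_zmultiples_iff.1
    (hall (mem_corankOneSpan.2 ⟨1, by rw [one_smul, hi₀]⟩))
  rw [hi₀] at hm₀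
  have hγ' : γ ∈ relRoots P θ := by
    refine hγ.resolve_left ?_
    rintro rfl
    exact hβ.1.1 (by simpa using hm₀.symm)
  obtain ⟨m, hm⟩ := AddSubgroup.mem_zmultiples_iff.1 (hall hi)
  -- As `β` is itself an integral multiple of `γ`, reducedness leaves only `γ = ±β`.
  rcases eq_or_eq_neg_of_zsmul hβ hγ' hm₀.symm with h | h
  · exact ⟨m, by rw [← hm, h]⟩
  · exact ⟨-m, by rw [← hm, h, neg_smul, smul_neg, neg_neg]⟩

theorem eq_or_eq_neg_of_smul (hθ : θ ⊆ Δ.support) {α β : RelSpace P θ}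
    (hα : α ∈ reducedRelRoots P θ) (hβ : β ∈ reducedRelRoots P θ) {c : ℝ} (h : α = c • β) :
    α = β ∨ α = -β := by
  obtain ⟨i, hi⟩ := hα.1.2
  obtain ⟨m, hm⟩ := exists_zsmul_of_mem_corankOneSpan Δ hθ hβ
    (mem_corankOneSpan.2 ⟨c, by rw [← h, hi]⟩ : i ∈ leviRoots P (corankOneSpan β))
  exact eq_or_eq_neg_of_zsmul hα hβ.1 (hi ▸ hm)

omit [Finite ι] [P.IsCrystallographic] in
theorem stabilizerRep_sub_mem {β : RelSpace P θ} (u : leviStabilizer P θ)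
    (hu : (u : P.weylGroup) ∈ leviWeyl P (corankOneSpan β)) (y : RelSpace P θ) :
    ∃ c : ℝ, stabilizerRep P θ u y - y = c • β := by
  obtain ⟨x, rfl⟩ := (leviSpan P θ).mkQ_surjective y
  obtain ⟨c, hc⟩ := mem_corankOneSpan.1 (smul_sub_mem hu x)
  exact ⟨c, by rw [hc, map_sub, stabilizerRep_mkQ]⟩

/-- An isometry preserving the line of `β` acts on it by `1` or `-1`. The value `1` is impossible:
`w_0^M` does not change restrictions to `𝔞_M^*`, whereas `w_0^{M_β}` reverses the sign of every root
of `M_β`. -/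
theorem stabilizerRep_relReflection (hθ : θ ⊆ Δ.support) {β : RelSpace P θ}
    (hβ : β ∈ relRoots P θ) (hw : relReflection Δ β ∈ leviStabilizer P θ) :
    stabilizerRep P θ ⟨relReflection Δ β, hw⟩ β = -β := by
  obtain ⟨B, -, hp, hB⟩ := exists_invariant_form (stabilizerRep P θ)
  set ρ := stabilizerRep P θ ⟨relReflection Δ β, hw⟩ with hρ
  obtain ⟨c, hc⟩ := stabilizerRep_sub_mem ⟨relReflection Δ β, hw⟩ (relReflection_mem Δ β) β
  have hc1 : ρ β = (c + 1) • β := by rw [add_smul, one_smul, ← hc, sub_add_cancel]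
  have h1 : B (ρ β) (ρ β) = B β β := hB _ _ _
  rw [hc1] at h1
  simp only [map_smul, LinearMap.smul_apply, smul_eq_mul] at h1
  have h2 : (c + 1 - 1) * (c + 1 + 1) = 0 := by
    have := hp β hβ.1
    refine (mul_eq_zero.1 (?_ : _ * B β β = 0)).resolve_right this.ne'
    linear_combination h1
  rcases mul_eq_zero.1 h2 with h3 | h3
  · exfalso
    have hfix : ρ β = β := by rw [hc1, sub_eq_zero.1 h3, one_smul]
    obtain ⟨h0, i, rfl⟩ := hβ
    have hi := mkQ_ne_zero.1 h0
    set i₀ := longest Δ (leviSpan P θ) • i with hi₀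
    have e0 : (leviSpan P θ).mkQ (P.root i₀) = (leviSpan P θ).mkQ (P.root i) := by
      rw [hi₀, root_smul, mkQ_smul_of_mem (longest_mem Δ _)]
    have e1 : (leviSpan P θ).mkQ (P.root (longest Δ (corankOneSpan
        ((leviSpan P θ).mkQ (P.root i))) • i₀)) = (leviSpan P θ).mkQ (P.root i) := by
      rw [hi₀, smul_smul, root_smul]
      exact hfix
    have p0 := isPos_iff_relHeight Δ hθ (mkQ_ne_zero.1 (e0 ▸ h0))
    have p1 := isPos_iff_relHeight Δ hθ (mkQ_ne_zero.1 (e1 ▸ h0))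
    rw [isPos_iff, e0] at p0
    rw [isPos_iff, e1, ← p0, height_longest_pos_iff Δ (mem_corankOneSpan.2 ⟨1, by
      rw [e0, one_smul]⟩)] at p1
    rcases (height_ne_zero Δ i₀).lt_or_gt with h | h
    · exact (p1.1 h).not_gt h
    · exact (p1.2 h).not_gt h
  · rw [hc1, eq_neg_of_add_eq_zero_left h3, neg_smul, one_smul]

omit [Finite ι] [P.IsCrystallographic] in
theorem height_neg_of_pos {μ : Dual ℝ V} {S : Submodule ℝ V}
    (h : ∀ i ∈ leviRoots P S, 0 < height Δ (P.root i) → 0 < μ (P.root i)) {i : ι}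
    (hi : i ∈ leviRoots P S) (hneg : height Δ (P.root i) < 0) : μ (P.root i) < 0 := by
  obtain ⟨j, hj⟩ := exists_neg_root (Q := P) i
  have := h j (by change P.root j ∈ S; rw [hj]; exact neg_mem hi) (by rw [hj, map_neg]; linarith)
  rw [hj, map_neg] at this
  linarith

/-- Any element of the Weyl group can be modified by an element of `W^L` such that it keeps the
positive roots of `L` positive. -/
theorem exists_mul_pos (S : Submodule ℝ V) (w : P.weylGroup) : ∃ h ∈ leviWeyl P S,
    ∀ i ∈ leviRoots P S, 0 < height Δ (P.root i) → 0 < height Δ (P.root ((w * h) • i)) := by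
  obtain ⟨h, hh, H⟩ := exists_leviWeyl_dominant (P := P) S (height Δ)
    (height Δ ∘ₗ P.weylGroupRootRep w)
  refine ⟨h, hh, fun i hi hpos ↦ lt_of_le_of_ne' ?_ (height_ne_zero Δ _)⟩
  rw [mul_smul, root_smul]
  exact H i hi hpos

/-- After correction by `W^M`, the element `u` becomes some `v` keeping the positive roots of `M`
positive, and then `v` equals `w_β` by freeness. Indeed both preserve signs on the roots of `M`
(`w_β` reverses them twice) and both reverse signs on the remaining roots of `M_β`. -/
theorem relReflection_mem_leviStabilizer (hθ : θ ⊆ Δ.support) {β : RelSpace P θ}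
    (u : leviStabilizer P θ)
    (huL : (u : P.weylGroup) ∈ leviWeyl P (corankOneSpan β)) (huβ : stabilizerRep P θ u β = -β) :
    relReflection Δ β ∈ leviStabilizer P θ := by
  obtain ⟨h, hh, hpos⟩ := exists_mul_pos Δ (leviSpan P θ) (u : P.weylGroup)
  set v := (u : P.weylGroup) * h with hv
  have hvs : v ∈ leviStabilizer P θ := mul_mem u.2 (leviWeyl_le_leviStabilizer hh)
  have hvL : v ∈ leviWeyl P (corankOneSpan β) :=
    mul_mem huL (leviWeyl_mono (leviSpan_le_corankOneSpan β) hh)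
  have hvneg {k : ι} (hk : k ∈ leviRoots P (corankOneSpan β)) :
      (leviSpan P θ).mkQ (P.root (v • k)) = -(leviSpan P θ).mkQ (P.root k) := by
    obtain ⟨c, hc⟩ := mem_corankOneSpan.1 hk
    rw [root_smul, hv, mul_smul, ← stabilizerRep_mkQ, mkQ_smul_of_mem hh, ← hc, map_smul, huβ,
      smul_neg]
  suffices relReflection Δ β * v⁻¹ = 1 by rwa [mul_inv_eq_one.1 this]
  refine leviWeyl_eq_one_of_pos Δ (mul_mem (relReflection_mem Δ β) (inv_mem hvL))
    fun i hi hipos ↦ ?_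
  obtain ⟨k, rfl⟩ := MulAction.surjective v i
  have hk := (smul_mem_leviRoots_iff hvL).1 hi
  have hkM : longest Δ (leviSpan P θ) • k ∈ leviRoots P (corankOneSpan β) :=
    (smul_mem_leviRoots_iff (leviWeyl_mono (leviSpan_le_corankOneSpan β) (longest_mem Δ _))).2 hk
  rw [mul_smul, inv_smul_smul, relReflection, mul_smul, height_longest_pos_iff Δ hkM]
  by_cases hkm : k ∈ leviRoots P (leviSpan P θ)
  · rw [height_longest_neg_iff Δ hkm]
    by_contra hc
    have := height_neg_of_pos Δ (μ := height Δ ∘ₗ P.weylGroupRootRep v) (S := leviSpan P θ)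
      (fun i hi hp ↦ by
        change 0 < height Δ (v • P.root i)
        rw [← root_smul]
        exact hpos i hi hp) hkm ((not_lt.1 hc).lt_of_ne (height_ne_zero Δ k))
    change height Δ (v • P.root k) < 0 at this
    rw [← root_smul] at this
    linarith
  · have e0 : (leviSpan P θ).mkQ (P.root (longest Δ (leviSpan P θ) • k)) =
        (leviSpan P θ).mkQ (P.root k) := by
      rw [root_smul, mkQ_smul_of_mem (longest_mem Δ _)]
    have h0 := mkQ_ne_zero.2 hkm
    have p0 := isPos_iff_relHeight Δ hθ (mkQ_ne_zero.1 (e0 ▸ h0))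
    have p1 := isPos_iff_relHeight Δ hθ (i := v • k)
      (mkQ_ne_zero.1 (by rw [hvneg hk]; exact neg_ne_zero.2 h0))
    rw [isPos_iff, hvneg hk, map_neg] at p1
    rw [isPos_iff, e0] at p0
    have p2 := p1.1 hipos
    refine (not_lt.1 fun hc ↦ ?_).lt_of_ne (height_ne_zero Δ _)
    have := p0.1 hc
    linarith

omit [Finite ι] [P.IsCrystallographic] in
theorem mem_leviWeyl_top (w : P.weylGroup) : w ∈ leviWeyl P ⊤ := by
  obtain ⟨w, hw⟩ := w
  induction hw using RootPairing.weylGroup.induction with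
  | one => exact one_mem (leviWeyl P ⊤)
  | mem i => exact Subgroup.subset_closure ⟨i, trivial, rfl⟩
  | mul u v hu hv ihu ihv => exact mul_mem ihu ihv

/-- The relative Weyl group acts faithfully on `𝔞_M^*`. -/
theorem mem_leviWeyl_of_stabilizerRep_eq_one (hθ : θ ⊆ Δ.support) (w : leviStabilizer P θ)
    (hw : stabilizerRep P θ w = 1) : (w : P.weylGroup) ∈ leviWeyl P (leviSpan P θ) := by
  obtain ⟨h, hh, hpos⟩ := exists_mul_pos Δ (leviSpan P θ) (w : P.weylGroup)
  suffices (w : P.weylGroup) * h = 1 by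
    rw [mul_eq_one_iff_eq_inv.1 this]
    exact inv_mem hh
  -- Roots of `M` stay positive by the choice of `h`; the others keep their restriction, hence their
  -- relative height.
  refine leviWeyl_eq_one_of_pos Δ (mem_leviWeyl_top _) fun i _ hi ↦ ?_
  by_cases him : P.root i ∈ leviSpan P θ
  · exact hpos i him hi
  have e : (leviSpan P θ).mkQ (P.root (((w : P.weylGroup) * h) • i)) =
      (leviSpan P θ).mkQ (P.root i) := by
    rw [root_smul, mul_smul, ← stabilizerRep_mkQ, hw, End.one_apply, mkQ_smul_of_mem hh]
  have p0 := isPos_iff_relHeight Δ hθ him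
  have p1 := isPos_iff_relHeight Δ hθ (mkQ_ne_zero.1 (e ▸ mkQ_ne_zero.2 him))
  rw [isPos_iff] at p0 p1
  rw [p1, e, ← p0]
  exact hi

theorem relRep_injective (hθ : θ ⊆ Δ.support) : Function.Injective (relRep P θ) := by
  refine (injective_iff_map_eq_one _).2 fun w hw ↦ ?_
  obtain ⟨w, rfl⟩ := QuotientGroup.mk_surjective w
  rw [QuotientGroup.eq_one_iff, Subgroup.mem_subgroupOf]
  exact mem_leviWeyl_of_stabilizerRep_eq_one Δ hθ w hw

theorem stabilizerRep_mem_relRootsZero (hθ : θ ⊆ Δ.support) (w : leviStabilizer P θ)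
    {β : RelSpace P θ} (hβ : β ∈ relRootsZero Δ θ) :
    stabilizerRep P θ w β ∈ relRootsZero Δ θ := by
  refine ⟨stabilizerRep_mem_reducedRelRoots w hβ.1, ?_⟩
  refine relReflection_mem_leviStabilizer Δ hθ (w * ⟨_, hβ.2⟩ * w⁻¹)
    (conj_mem_leviWeyl w (relReflection_mem Δ β)) ?_
  rw [map_mul, map_mul, End.mul_apply, End.mul_apply, stabilizerRep_inv_apply,
    stabilizerRep_relReflection Δ hθ hβ.1.1, map_neg]

/-- The relative reflection acts as a reflection, with integral values at the relative roots. -/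
theorem exists_coroot (hθ : θ ⊆ Δ.support) (β : relRootsZero Δ θ) :
    ∃ f : Dual ℝ (RelSpace P θ), f β = 2 ∧
      (∀ x, relRep P θ (relReflectionClass Δ β) x = x - f x • (β : RelSpace P θ)) ∧
      ∀ γ ∈ relRoots P θ, ∃ m : ℤ, f γ = m := by
  obtain ⟨β, hβ⟩ := β
  obtain ⟨e, he⟩ := exists_dual_forall_apply_eq_one (K := ℝ) (v := id) (s := {β})
    (by simpa using hβ.1.1.1 : LinearIndepOn ℝ id {β})
  have he : e β = 1 := by simpa using he
  let ρ := stabilizerRep P θ ⟨relReflection Δ β, hβ.2⟩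
  have hρ (x) : ∃ c : ℝ, ρ x - x = c • β :=
    stabilizerRep_sub_mem ⟨relReflection Δ β, hβ.2⟩ (relReflection_mem Δ β) x
  have hf (x : RelSpace P θ) : e (x - ρ x) • β = x - ρ x := by
    obtain ⟨c, hc⟩ := hρ x
    have : x - ρ x = (-c) • β := by rw [neg_smul, ← hc, neg_sub]
    rw [this, map_smul, he, smul_eq_mul, mul_one]
  -- Since `x - ρ x` is a multiple of `β` and `e β = 1`, this functional reads off the coefficient.
  refine ⟨e ∘ₗ (1 - ρ), ?_, fun x ↦ ?_, ?_⟩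
  · change e (β - ρ β) = 2
    rw [stabilizerRep_relReflection Δ hθ hβ.1.1 hβ.2, sub_neg_eq_add, map_add, he]
    norm_num
  · change ρ x = x - e (x - ρ x) • β
    rw [hf, sub_sub_cancel]
  · rintro _ ⟨-, i, rfl⟩
    change ∃ m : ℤ, e ((leviSpan P θ).mkQ (P.root i) - ρ ((leviSpan P θ).mkQ (P.root i))) = m
    have h1 := smul_root_sub_mem_closure (relReflection_mem Δ β) i
    have h2 : ∀ x ∈ AddSubgroup.closure (P.root '' leviRoots P (corankOneSpan β)),
        (leviSpan P θ).mkQ x ∈ AddSubgroup.zmultiples β := by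
      intro x hx
      induction hx using AddSubgroup.closure_induction with
      | mem x hx =>
        obtain ⟨j, hj, rfl⟩ := hx
        obtain ⟨m, hm⟩ := exists_zsmul_of_mem_corankOneSpan Δ hθ hβ.1 hj
        exact ⟨m, hm.symm⟩
      | zero => simp
      | add x y _ _ hx hy => rw [map_add]; exact add_mem hx hy
      | neg x _ hx => rw [map_neg]; exact neg_mem hx
    obtain ⟨m, hm⟩ := AddSubgroup.mem_zmultiples_iff.1 (h2 _ h1)
    refine ⟨-m, ?_⟩
    rw [← neg_sub, map_neg, Int.cast_neg, neg_inj]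
    change e ((leviSpan P θ).mkQ (relReflection Δ β • P.root i) - _) = _
    rw [← map_sub, ← hm, map_zsmul, he]
    simp

end Relative

/-! ### Abstract reflection data and the complement theorem -/

/-- A faithful representation `ρ` of a group together with a stable set of vectors, elements of the
group acting as integral reflections in these vectors, and a functional defining positivity. -/
structure ReflectionDatum {E G : Type*} [AddCommGroup E] [Module ℝ E] [Group G]
    (ρ : G →* End ℝ E) (A : Set E) where
  refl : A → G
  coroot : A → Dual ℝ E
  pos : Dual ℝ E
  injective : Function.Injective ρ
  finite : A.Finite
  coroot_self (a : A) : coroot a a = 2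
  refl_apply (a : A) (x : E) : ρ (refl a) x = x - coroot a x • (a : E)
  map_mem (g : G) {a : E} (ha : a ∈ A) : ρ g a ∈ A
  exists_int (a b : A) : ∃ m : ℤ, coroot a b = m
  eq_or_eq_neg {a b : E} (ha : a ∈ A) (hb : b ∈ A) (c : ℝ) (h : a = c • b) : a = b ∨ a = -b
  pos_ne_zero {a : E} (ha : a ∈ A) : pos a ≠ 0

namespace ReflectionDatum

variable {E G : Type*} [AddCommGroup E] [Module ℝ E] [FiniteDimensional ℝ E] [Group G] [Finite G]
  {ρ : G →* End ℝ E} {A : Set E} (D : ReflectionDatum ρ A)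

omit [FiniteDimensional ℝ E] [Finite G] in
theorem coroot_apply_mul {B : LinearMap.BilinForm ℝ E} (hB : ∀ g x y, B (ρ g x) (ρ g y) = B x y)
    (a : A) (x : E) : D.coroot a x * B a a = 2 * B x a :=
  mul_form_eq_of_reflection (hB (D.refl a)) (D.refl_apply a) (D.coroot_self a) x

omit [FiniteDimensional ℝ E] [Finite G] in
theorem ne_zero (D : ReflectionDatum ρ A) (a : A) : (a : E) ≠ 0 := by
  intro h
  have := D.coroot_self a
  rw [h, map_zero] at this
  norm_num at this

/-- A coroot determines its root up to scale through the invariant form, hence up to sign by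
`eq_or_eq_neg`; the sign is fixed by the value `2`. -/
theorem coroot_injective : Function.Injective D.coroot := by
  obtain ⟨B, hs, hp, hB⟩ := exists_invariant_form ρ
  intro a b hab
  have ha := hp a (D.ne_zero a)
  have hb := hp b (D.ne_zero b)
  have h1 : (a : E) = (B a a / B b b) • (b : E) := by
    rw [← sub_eq_zero]
    by_contra hne
    refine (hp _ hne).ne' ?_
    set x := (a : E) - (B a a / B b b) • (b : E) with hx
    have e1 := D.coroot_apply_mul hB a x
    have e2 := D.coroot_apply_mul hB b x
    rw [hab] at e1
    conv_lhs => rw [hx]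
    rw [hs, map_sub, map_smul, smul_eq_mul]
    field_simp
    linear_combination (B a a * e2 - B b b * e1) / 2
  rcases D.eq_or_eq_neg a.2 b.2 _ h1 with h | h
  · exact Subtype.ext h
  · have e1 := D.coroot_self a
    rw [hab, h, map_neg, D.coroot_self b] at e1
    norm_num at e1

/-- The root pairing defined by a reflection datum. -/
def rootPairing : RootPairing A ℝ E (Dual ℝ E) :=
  have := D.finite.to_subtype
  RootPairing.mk' (Dual.eval ℝ E) (Function.Embedding.subtype _) ⟨D.coroot, D.coroot_injective⟩
    D.coroot_self
    (by
      rintro a _ ⟨b, rfl⟩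
      refine ⟨⟨ρ (D.refl a) b, D.map_mem _ b.2⟩, ?_⟩
      exact D.refl_apply a b)
    (by
      rintro a _ ⟨b, rfl⟩
      refine ⟨⟨ρ (D.refl a) b, D.map_mem _ b.2⟩, ?_⟩
      obtain ⟨B, hs, hp, hB⟩ := exists_invariant_form ρ
      ext x
      -- Each coroot is `2 B(·, a) / B(a, a)`, so stability of the coroots follows from invariance
      -- of `B`.
      change D.coroot _ x = D.coroot b x - D.coroot b a * D.coroot a x
      have h1 := D.coroot_apply_mul hB ⟨ρ (D.refl a) b, D.map_mem _ b.2⟩ x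
      have h2 := D.coroot_apply_mul hB b x
      have h3 := D.coroot_apply_mul hB a x
      have h4 := D.coroot_apply_mul hB b a
      have h5 := D.coroot_apply_mul hB a b
      rw [hs b a] at h5
      simp only [hB] at h1
      have h6 : B x (ρ (D.refl a) b) = B x b - D.coroot a b * B x a := by
        rw [D.refl_apply, map_sub, map_smul, smul_eq_mul]
      rw [h6] at h1
      refine mul_right_cancel₀ (hp b (D.ne_zero b)).ne' ?_
      linear_combination h1 - h2 + D.coroot a x * (h4 - h5) + D.coroot a b * h3)

theorem rootPairing_reflection (a : A) (x : E) : D.rootPairing.reflection a x = ρ (D.refl a) x :=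
  (D.refl_apply a x).symm

instance : D.rootPairing.IsCrystallographic where
  exists_value a b := by
    obtain ⟨m, hm⟩ := D.exists_int b a
    exact ⟨m, hm.symm⟩

theorem rootPairing_isReduced : D.rootPairing.IsReduced where
  eq_or_eq_neg a b h := by
    change ¬ LinearIndependent ℝ ![(a : E), (b : E)] at h
    change (a : E) = b ∨ (a : E) = -b
    rw [LinearIndependent.pair_iff' (D.ne_zero a)] at h
    push Not at h
    obtain ⟨c, hc⟩ := h
    rcases D.eq_or_eq_neg b.2 a.2 c hc.symm with h | h
    · exact .inl h.symm
    · exact .inr (by rw [h, neg_neg])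

omit [FiniteDimensional ℝ E] [Finite G] in
theorem inv_apply_apply (g : G) (x : E) : ρ g⁻¹ (ρ g x) = x := by
  rw [← End.mul_apply, ← map_mul, inv_mul_cancel, map_one, End.one_apply]

omit [FiniteDimensional ℝ E] [Finite G] in
theorem apply_inv_apply (g : G) (x : E) : ρ g (ρ g⁻¹ x) = x := by
  rw [← End.mul_apply, ← map_mul, mul_inv_cancel, map_one, End.one_apply]

theorem conj_refl (g : G) (a : A) : g * D.refl a * g⁻¹ = D.refl ⟨ρ g a, D.map_mem g a.2⟩ := by
  obtain ⟨B, hs, hp, hB⟩ := exists_invariant_form ρ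
  apply D.injective
  ext x
  rw [map_mul, map_mul, End.mul_apply, End.mul_apply, D.refl_apply, D.refl_apply, map_sub, map_smul,
    apply_inv_apply]
  congr 2
  have h1 := D.coroot_apply_mul hB a (ρ g⁻¹ x)
  have h2 := D.coroot_apply_mul hB ⟨ρ g a, D.map_mem g a.2⟩ x
  rw [← hB g (ρ g⁻¹ x), apply_inv_apply g x, ← hB g a] at h1
  simp only [hB] at h1 h2
  exact mul_right_cancel₀ (hp a (D.ne_zero a)).ne' (h1.trans h2.symm)

/-- The subgroup generated by the reflections. -/
def reflSubgroup : Subgroup G := Subgroup.closure (Set.range D.refl)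

theorem reflSubgroup_normal : D.reflSubgroup.Normal := by
  refine ⟨fun n hn g ↦ ?_⟩
  suffices D.reflSubgroup ≤ D.reflSubgroup.comap (MulAut.conj g).toMonoidHom from this hn
  conv_lhs => rw [reflSubgroup]
  rw [Subgroup.closure_le]
  rintro _ ⟨a, rfl⟩
  change g * D.refl a * g⁻¹ ∈ D.reflSubgroup
  rw [conj_refl]
  exact Subgroup.subset_closure ⟨_, rfl⟩

omit [FiniteDimensional ℝ E] [Finite G] in
-- An injective map of a finite set into itself is onto. This is why the condition defining `W_M^1`
-- is closed under inverses.
theorem image_pos_eq_iff (g : G) : ρ g '' {a ∈ A | 0 < D.pos a} = {a ∈ A | 0 < D.pos a} ↔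
    ∀ a ∈ A, 0 < D.pos a → 0 < D.pos (ρ g a) := by
  constructor
  · intro h a ha hpos
    have : ρ g a ∈ {a ∈ A | 0 < D.pos a} := h ▸ ⟨a, ⟨ha, hpos⟩, rfl⟩
    exact this.2
  · intro h
    have hsub : ρ g '' {a ∈ A | 0 < D.pos a} ⊆ {a ∈ A | 0 < D.pos a} := by
      rintro _ ⟨a, ⟨ha, hpos⟩, rfl⟩
      exact ⟨D.map_mem g ha, h a ha hpos⟩
    have hfin : {a ∈ A | 0 < D.pos a}.Finite := D.finite.subset fun a h ↦ h.1
    refine Set.eq_of_subset_of_ncard_le hsub ?_ hfin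
    rw [Set.ncard_image_of_injective _ (Function.LeftInverse.injective (inv_apply_apply g))]

/-- The stabilizer of the set of positive roots. -/
def posStabilizer : Subgroup G where
  carrier := {g | ρ g '' {a ∈ A | 0 < D.pos a} = {a ∈ A | 0 < D.pos a}}
  one_mem' := by simp
  mul_mem' {g h} hg hh := by
    rw [Set.mem_ofPred_eq] at hg hh ⊢
    rw [map_mul, End.mul_eq_comp, LinearMap.coe_comp, Set.image_comp, hh, hg]
  inv_mem' {g} hg := by
    rw [Set.mem_ofPred_eq] at hg ⊢
    conv_lhs => rw [← hg]
    rw [← Set.image_comp]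
    convert Set.image_id _
    ext x
    exact inv_apply_apply g x

omit [FiniteDimensional ℝ E] [Finite G] in
theorem mem_posStabilizer {g : G} :
    g ∈ D.posStabilizer ↔ ∀ a ∈ A, 0 < D.pos a → 0 < D.pos (ρ g a) :=
  D.image_pos_eq_iff g

/-- The intersection is trivial by freeness and faithfulness. For the product, a reflection element
`h` dominant for `D.pos ∘ₗ ρ g` makes `g * h` preserve the positive roots. -/
theorem isComplement' : D.reflSubgroup.IsComplement' D.posStabilizer := by
  refine Subgroup.isComplement'_of_disjoint_and_mul_eq_univ ?_ ?_
  · rw [Subgroup.disjoint_def]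
    intro g hg hg'
    let ρ' : G →* (E ≃ₗ[ℝ] E) :=
      (LinearMap.GeneralLinearGroup.generalLinearEquiv ℝ E).toMonoidHom.comp ρ.toHomUnits
    have hρ' (g : G) (x : E) : ρ' g x = ρ g x := rfl
    have hmem : ρ' g ∈ Subgroup.closure (Set.range D.rootPairing.reflection) := by
      suffices D.reflSubgroup ≤
        (Subgroup.closure (Set.range D.rootPairing.reflection)).comap ρ' from this hg
      rw [reflSubgroup, Subgroup.closure_le]
      rintro _ ⟨a, rfl⟩
      refine Subgroup.subset_closure ⟨a, ?_⟩
      ext x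
      rw [hρ', rootPairing_reflection]
    have := D.finite.to_subtype
    have h1 := eq_one_of_pos (Q := D.rootPairing) (l := D.pos) (fun a ↦ D.pos_ne_zero a.2) hmem
      fun a ↦ D.mem_posStabilizer.1 hg' a a.2
    apply D.injective
    ext x
    rw [← hρ', h1, map_one]
    rfl
  · refine Set.eq_univ_of_forall fun g ↦ ?_
    obtain ⟨h, hh, H⟩ := exists_dominant ρ D.reflSubgroup A
      (fun a ha ↦ ⟨_, Subgroup.subset_closure ⟨⟨a, ha⟩, rfl⟩, _, D.coroot_self ⟨a, ha⟩,
        D.refl_apply ⟨a, ha⟩⟩) D.pos (D.pos ∘ₗ ρ g)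
    have hk : g * h ∈ D.posStabilizer := by
      refine D.mem_posStabilizer.2 fun a ha hpos ↦ ?_
      rw [map_mul, End.mul_apply]
      exact (H a ha hpos).lt_of_ne' (D.pos_ne_zero (D.map_mem g (D.map_mem h ha)))
    -- Normality moves `h⁻¹` across `g * h`, so that the reflection factor stands on the left.
    exact ⟨_, D.reflSubgroup_normal.conj_mem _ (inv_mem hh) (g * h), _, hk, by group⟩

end ReflectionDatum

/-! ### The relative Weyl group as a reflection datum -/

section Main

variable {ι V V' : Type*} [Finite ι] [AddCommGroup V] [Module ℝ V] [AddCommGroup V'] [Module ℝ V']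
  {P : RootPairing ι ℝ V V'} [P.IsCrystallographic] (Δ : SimpleRoots P) {θ : Set ι}

/-- The relative Weyl group acting on `𝔞_M^*` with the relative reflections. -/
def relDatum (hθ : θ ⊆ Δ.support) : ReflectionDatum (relRep P θ) (relRootsZero Δ θ) where
  refl := relReflectionClass Δ
  coroot β := (exists_coroot Δ hθ β).choose
  pos := relHeight Δ hθ
  injective := relRep_injective Δ hθ
  finite := (Set.finite_range fun i ↦ (leviSpan P θ).mkQ (P.root i)).subset fun _ h ↦ h.1.1.2
  coroot_self β := (exists_coroot Δ hθ β).choose_spec.1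
  refl_apply β := (exists_coroot Δ hθ β).choose_spec.2.1
  map_mem g := by
    obtain ⟨g, rfl⟩ := QuotientGroup.mk_surjective g
    exact stabilizerRep_mem_relRootsZero Δ hθ g
  exists_int α β := (exists_coroot Δ hθ α).choose_spec.2.2 β β.2.1.1
  eq_or_eq_neg hα hβ c h := eq_or_eq_neg_of_smul Δ hθ hα.1 hβ.1 h
  pos_ne_zero hβ := relHeight_ne_zero Δ hθ hβ.1.1

theorem relRootsZeroPos_eq (hθ : θ ⊆ Δ.support) : relRootsZeroPos Δ θ =
    {β ∈ relRootsZero Δ θ | 0 < (relDatum Δ hθ).pos β} := by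
  ext β
  exact and_congr_right fun h ↦ isRelPos_iff Δ hθ h.1.1

end Main

end RelativeWeyl

end

theorem mainTheorem2 {ι V V' : Type*} [Finite ι] [AddCommGroup V] [Module ℝ V]
    [AddCommGroup V'] [Module ℝ V'] (P : RootPairing ι ℝ V V') [P.IsCrystallographic]
    (Δ : RelativeWeyl.SimpleRoots P) (θ : Set ι) (hθ : θ ⊆ Δ.support) :
    (∃ H : Subgroup (RelativeWeyl.RelWeylGroup P θ),
      (H : Set (RelativeWeyl.RelWeylGroup P θ)) = RelativeWeyl.relWeylOne Δ θ ∧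
      (∀ w, w ∈ H ↔ RelativeWeyl.relRep P θ w '' RelativeWeyl.relRootsZeroPos Δ θ =
        RelativeWeyl.relRootsZeroPos Δ θ) ∧
      (RelativeWeyl.relWeylZero Δ θ).Normal ∧
      (RelativeWeyl.relWeylZero Δ θ).IsComplement' H) ∧
    (RelativeWeyl.relRootsZero Δ θ).Finite ∧
    ∃ R : RootPairing (RelativeWeyl.relRootsZero Δ θ) ℝ (RelativeWeyl.RelSpace P θ)
        (Module.Dual ℝ (RelativeWeyl.RelSpace P θ)),
      (∀ x f, R.toLinearMap x f = f x) ∧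
      (∀ β, R.root β = (β : RelativeWeyl.RelSpace P θ)) ∧
      R.IsCrystallographic ∧ R.IsReduced ∧
      ∀ β x, R.reflection β x =
        RelativeWeyl.relRep P θ (RelativeWeyl.relReflectionClass Δ β) x := by
  let D := RelativeWeyl.relDatum Δ hθ
  have hpos := RelativeWeyl.relRootsZeroPos_eq Δ hθ
  refine ⟨⟨D.posStabilizer, ?_, ?_, D.reflSubgroup_normal, D.isComplement'⟩, D.finite,
    D.rootPairing, fun _ _ ↦ rfl, fun _ ↦ rfl, inferInstance, D.rootPairing_isReduced,
    D.rootPairing_reflection⟩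
  · ext w
    rw [SetLike.mem_coe, D.mem_posStabilizer]
    -- Images of `Φ_M^0` stay in `Φ_M^0`, where `IsRelPos` and positivity of the relative height
    -- agree.
    refine ⟨fun h β hβ ↦ ?_, fun h β hβ hp ↦ ?_⟩
    · rw [hpos] at hβ
      exact (RelativeWeyl.isRelPos_iff Δ hθ (D.map_mem w hβ.1).1.1).2 (h β hβ.1 hβ.2)
    · exact (RelativeWeyl.isRelPos_iff Δ hθ (D.map_mem w hβ).1.1).1 (h β (hpos ▸ ⟨hβ, hp⟩))
  · intro w
    rw [hpos]
    rfl
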